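/- Let $d=3$ and let $p$ be the transition kernel of the simple nearest-neighbour random walk on $\mathbb Z^3$, so $p(x)=\frac16$ if $|x|_1=1$ and $p(x)=0$ otherwise; write $i\sim j$ if $p(i-j)>0$. Let $V(t)=t^2/2$, and let $\eta=(\eta_i)_{i\in\mathbb Z^3}$ be i.i.d. real random variables with finite second moment; write $\mathbb E$ for the expectation over $\eta$. For a finite set $\Lambda\subset\mathbb Z^3$ and a boundary condition $\hat\varphi$, the finite-volume Gibbs measure $\mu_\Lambda^{\hat\varphi}[\eta]$ is the probability measure on configurations $\varphi\in\mathbb R^{\mathbb Z^3}$ with $\varphi=\hat\varphi$ off $\Lambda$ whose density with respect to $\prod_{i\in\Lambda}d\varphi_i$ is proportional to $$\exp\Big\{-\tfrac12\sum_{i,j\in\Lambda}p(i-j)V(\varphi_i-\varphi_j)-\sum_{i\in\Lambda,\,j\notin\Lambda}p(i-j)V(\varphi_i-\hat\varphi_j)+\sum_{i\in\Lambda}\eta_i\varphi_i\Big\}.$$ The gradient field of $\varphi$ is $\varphi'_{ij}=\varphi_i-\varphi_j$ ($i\sim j$). The image of $\mu_\Lambda^{\hat\varphi}[\eta]$ under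 $\varphi\mapsto\varphi'$ depends on $\hat\varphi$ only through $\hat\varphi'$; a probability measure on gradient fields is a gradient Gibbs measure for $\eta$ if it is invariant under these kernels for every finite $\Lambda$ (DLR equations). Let $\eta\mapsto\mu'[\eta]$ be a translation-covariant random gradient Gibbs measure, that is, a measurable map into the probability measures on gradient fields such that, for almost every $\eta$, $\mu'[\eta]$ is a gradient Gibbs measure for $\eta$, and such that for every $r\in\mathbb Z^3$ and almost every $\eta$, $\mu'[\tau_r\eta]$ is the image of $\mu'[\eta]$ under $\tau_r$, where $(\tau_r\eta)_i=\eta_{i-r}$ and $(\tau_r\varphi')_{ij}=\varphi'_{i-r,j-r}$. Assume that for all $i\sim j$, $V'(\varphi'_{ij})$ is $\mu'[\eta]$-integrable for almost every $\eta$ and that $$X_{ij}[\eta]:=\int\mu'[\eta](d\varphi')\,V'(\varphi'_{ij})$$ satisfies $\mathbb E|X_{ij}|<\infty$. Then $\mathbb E(X_{ij}^2)<\infty$ for all $i\sim j$, and $$\limsup_{r\uparrow\infty}\ \sup_{i\sim j,\;k\sim l,\;|i-k|\ge r}\frac{|\operatorname{Cov}(X_{ij},X_{kl})|}{r^{-1}}<\infty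 ,$$ where $\operatorname{Cov}$ is the covariance under the law of $\eta$. In particular, if $\mu'$ has no tilt, that is, $\mathbb E(X_{ij})=0$ for all $i\sim j$, then $C(ij,kl):=\mathbb E(X_{ij}X_{kl})$ satisfies $$\limsup_{r\uparrow\infty}\ \sup_{i\sim j,\;k\sim l,\;|i-k|\ge r}\frac{|C(ij,kl)|}{r^{-1}}<\infty .$$ -/

import Mathlib

open MeasureTheory ProbabilityTheory Filter
open scoped ENNReal

namespace RandomInterface

noncomputable section

/-- Sites of the lattice `ℤ^d`. -/
abbrev Site (d : ℕ) := Fin d → ℤ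

/-- Euclidean distance of two sites. -/
def siteDist {d : ℕ} (i j : Site d) : ℝ := Real.sqrt (∑ k, ((i k : ℝ) - (j k : ℝ)) ^ 2)

/-- Transition kernel of the simple (nearest-neighbour) random walk on `ℤ^d`. -/
def nnKernel (d : ℕ) (x : Site d) : ℝ := if ∑ k, |x k| = 1 then 1 / (2 * (d : ℝ)) else 0

/-- The Gaussian pair potential. -/
def gaussianPotential (t : ℝ) : ℝ := t ^ 2 / 2

/-- Oriented edges `ij` of the graph of the random walk with transition kernel `p`. -/
abbrev Edge {d : ℕ} (p : Site d → ℝ) := {e : Site d × Site d // 0 < p (e.1 - e.2)}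

/-- The gradient field `φ'_{ij} = φ_i - φ_j` of a height configuration. -/
def grad {d : ℕ} (p : Site d → ℝ) (φ : Site d → ℝ) : Edge p → ℝ := fun e => φ e.1.1 - φ e.1.2

/-- The set of gradient field configurations, with the σ-algebra generated by the coordinates. -/
abbrev GradConf {d : ℕ} (p : Site d → ℝ) := {u : Edge p → ℝ // ∃ φ : Site d → ℝ, grad p φ = u}

/-- The gradient field of `φ`, as an element of the set of gradient configurations. -/
def toGradConf {d : ℕ} (p : Site d → ℝ) (φ : Site d → ℝ) : GradConf p := ⟨grad p φ, φ, rfl⟩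

theorem exists_potential {d : ℕ} {p : Site d → ℝ} (u : GradConf p) :
    ∃ φ : Site d → ℝ, φ 0 = 0 ∧ grad p φ = u.1 := by
  obtain ⟨φ, hφ⟩ := u.2
  refine ⟨fun i => φ i - φ 0, sub_self _, ?_⟩
  rw [← hφ]
  funext e
  simp [grad]

/-- A height configuration with gradient field `u`, normalized to vanish at the origin. -/
def potential {d : ℕ} {p : Site d → ℝ} (u : GradConf p) : Site d → ℝ :=
  Classical.choose (exists_potential u)

/-- The configuration equal to `x` in `Λ` and to the boundary condition `b` outside `Λ`. -/
def glue {d : ℕ} (Λ : Finset (Site d)) (b : Site d → ℝ) (x : Λ → ℝ) : Site d → ℝ :=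
  fun i => if h : i ∈ Λ then x ⟨i, h⟩ else b i

/-- The Hamiltonian in the finite volume `Λ`, including the interaction with the outside. -/
def energy {d : ℕ} (p : Site d → ℝ) (V : ℝ → ℝ) (Λ : Finset (Site d)) (η φ : Site d → ℝ) : ℝ :=
  1 / 2 * ∑ i ∈ Λ, ∑ j ∈ Λ, p (i - j) * V (φ i - φ j)
    + ∑ i ∈ Λ, ∑' j : {j : Site d // j ∉ Λ}, p (i - j) * V (φ i - φ j)
    - ∑ i ∈ Λ, η i * φ i

/-- The Boltzmann weight of the heights in `Λ`, for the boundary condition `b`. -/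
def weight {d : ℕ} (p : Site d → ℝ) (V : ℝ → ℝ) (Λ : Finset (Site d)) (η b : Site d → ℝ)
    (x : Λ → ℝ) : ℝ≥0∞ :=
  ENNReal.ofReal (Real.exp (-energy p V Λ η (glue Λ b x)))

/-- The quenched finite-volume Gibbs measure with boundary condition `b`. -/
def finiteGibbs {d : ℕ} (p : Site d → ℝ) (V : ℝ → ℝ) (Λ : Finset (Site d)) (η b : Site d → ℝ) :
    Measure (Site d → ℝ) :=
  (∫⁻ x, weight p V Λ η b x)⁻¹ •
    ((volume : Measure (Λ → ℝ)).withDensity (weight p V Λ η b)).map (glue Λ b)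

/-- The gradient finite-volume Gibbs measure with gradient boundary condition `u`. -/
def finiteGradGibbs {d : ℕ} (p : Site d → ℝ) (V : ℝ → ℝ) (Λ : Finset (Site d)) (η : Site d → ℝ)
    (u : GradConf p) : Measure (GradConf p) :=
  (finiteGibbs p V Λ η (potential u)).map (toGradConf p)

/-- The DLR equations, in every finite volume, for a measure on gradient configurations. -/
def IsGradientGibbs {d : ℕ} (p : Site d → ℝ) (V : ℝ → ℝ) (η : Site d → ℝ)
    (μ : Measure (GradConf p)) : Prop :=
  ∀ (Λ : Finset (Site d)) (A : Set (GradConf p)), MeasurableSet A →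
    ∫⁻ u, finiteGradGibbs p V Λ η u A ∂μ = μ A

/-- The lattice shift `(τ_r η)_i = η_{i - r}`. -/
def shift {d : ℕ} (r : Site d) (η : Site d → ℝ) : Site d → ℝ := fun i => η (i - r)

/-- The shift of gradient configurations, `(τ_r u)_{ij} = u_{i - r, j - r}`. -/
def shiftGrad {d : ℕ} {p : Site d → ℝ} (r : Site d) (u : GradConf p) : GradConf p :=
  ⟨fun e => u.1 ⟨(e.1.1 - r, e.1.2 - r), by simpa using e.2⟩, by
    obtain ⟨φ, hφ⟩ := u.2
    refine ⟨shift r φ, ?_⟩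
    rw [← hφ]
    rfl⟩

/-- The law of an i.i.d. disorder configuration with single-site distribution `ν`. -/
def disorderLaw (d : ℕ) (ν : Measure ℝ) [IsProbabilityMeasure ν] : Measure (Site d → ℝ) :=
  Measure.infinitePi (fun _ : Site d => ν)

/-- `η ↦ μ[η]` is a translation-covariant random gradient Gibbs measure under the law `P` of the
disorder: its values are probability measures depending measurably on `η` (a Markov kernel), almost
surely they satisfy the DLR equations, and they are covariant under lattice shifts. -/
structure IsRandomGradientGibbs {d : ℕ} (p : Site d → ℝ) (V : ℝ → ℝ) (P : Measure (Site d → ℝ))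
    (μ : Kernel (Site d → ℝ) (GradConf p)) : Prop where
  markov : IsMarkovKernel μ
  gibbs : ∀ᵐ η ∂P, IsGradientGibbs p V η (μ η)
  covariant : ∀ r : Site d, ∀ᵐ η ∂P, μ (shift r η) = (μ η).map (shiftGrad r)

/-- The associated vector field `X_{ij}[η] = ∫ V'(φ'_{ij}) dμ[η]`. -/
def vectorField {d : ℕ} {p : Site d → ℝ} (V : ℝ → ℝ) (μ : Kernel (Site d → ℝ) (GradConf p))
    (e : Edge p) (η : Site d → ℝ) : ℝ :=
  ∫ u, deriv V (u.1 e) ∂(μ η)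

/-- The supremum of `|D(ij, kl)| / r⁻¹` over all edges `ij`, `kl` with `|i - k| ≥ r`,
as an extended nonnegative number. -/
def decaySup {d : ℕ} {p : Site d → ℝ} (D : Edge p → Edge p → ℝ) (r : ℝ) : ℝ≥0∞ :=
  ⨆ (e : Edge p) (f : Edge p) (_ : r ≤ siteDist e.1.1 f.1.1), ENNReal.ofReal (|D e f| / r⁻¹)

end

end RandomInterface

open RandomInterface

/-! For the quadratic potential the field is linear in the disorder. The one-site DLR equation says
that the divergence of the gradient field at `i` is Gaussian with mean `η i` (`map_divergence`), so
the mean gradient field `X` has divergence `η`, and it is curl-free, being a mean of gradients. Let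
`Q = (1 + P) / 2` be the lazy walk, where `P` is the simple walk. For each unit vector `a` the
function `x ↦ X_{x,x+a}` then satisfies `(1 - Q) X = (1/2) (η_x - η_{x+a})`. Multiplying by `1 + Q +
... + Q^(n-1)` gives `meanDiff_eq`: `X` is a finite-time Green gradient applied to `η`, plus `Q^n
X`.

By translation covariance `Q^n X` is an average of an integrable variable along lattice shifts of
i.i.d. disorder, so it tends in `L¹` to the mean of `X` (`isMixing_of_integrable`). The Green part
is a finite linear combination of the `η_y`. Its covariances are `Var ν / 4` times `∑_{k,l<n}
∇∇Q^(k+l)(z)`, where `z` is the displacement between the base points of the two edges. It is Cauchy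
in `L²`, since `|∇∇Q^m| ≤ C m^(-5/2)`; hence `X` minus its mean is its `L²` limit, which gives the
second moments. The covariance bound for the Green part is uniform in `n` and passes to the limit:
combining the bound above with `|z|² |∇∇Q^m(z)| ≤ C m^(-3/2)` and counting about `m` pairs with `k +
l = m`, the sum is `O(1/|z|)`.

The heat kernel bounds are obtained without Fourier analysis, in the group algebra of `ℤ³`. One
gradient of `Q^n` has `ℓ¹` norm `O(n^(-1/2))`; splitting the time makes the orders of gradients add;
a discrete Sobolev inequality turns three further gradients into a sup bound; and multiplication by
a coordinate is a derivation, so Leibniz' rule gives the spatial decay. -/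

namespace RandomInterface

noncomputable section

/-! ### Convolution in the group algebra: `ℓ¹` norm, moments, and near-invariance of convolution
powers. -/

section GroupAlgebra

open AddMonoidAlgebra

variable {G H : Type*}

/-- The pairing of a finitely supported function with an arbitrary function. -/
def pairing (h : G → ℝ) : AddMonoidAlgebra ℝ G →ₗ[ℝ] ℝ :=
  (Finsupp.lsum ℝ fun x => (LinearMap.id : ℝ →ₗ[ℝ] ℝ).smulRight (h x)) ∘ₗ
    (coeffLinearEquiv ℝ).toLinearMap

@[simp] theorem pairing_single (h : G → ℝ) (x : G) (r : ℝ) : pairing h (single x r) = r * h x := by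
  simp [pairing]

theorem pairing_eq_sum (h : G → ℝ) (f : AddMonoidAlgebra ℝ G) :
    pairing h f = ∑ x ∈ f.coeff.support, f.coeff x * h x := by
  simp [pairing, Finsupp.sum]

/-- The `ℓ¹` norm of an element of the group algebra. -/
def l1 (f : AddMonoidAlgebra ℝ G) : ℝ := ∑ x ∈ f.coeff.support, |f.coeff x|

theorem l1_eq_sum {f : AddMonoidAlgebra ℝ G} {s : Finset G} (hs : f.coeff.support ⊆ s) :
    l1 f = ∑ x ∈ s, |f.coeff x| :=
  Finset.sum_subset hs fun x _ hx => by simpa using hx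

theorem l1_nonneg (f : AddMonoidAlgebra ℝ G) : 0 ≤ l1 f := Finset.sum_nonneg fun _ _ => abs_nonneg _

theorem l1_add_le (f g : AddMonoidAlgebra ℝ G) : l1 (f + g) ≤ l1 f + l1 g := by
  classical
  have h : (f + g).coeff.support ⊆ f.coeff.support ∪ g.coeff.support := by
    rw [coeff_add]; exact Finsupp.support_add
  rw [l1_eq_sum h, l1_eq_sum (Finset.subset_union_left (s₂ := g.coeff.support)),
    l1_eq_sum (Finset.subset_union_right (s₁ := f.coeff.support)), ← Finset.sum_add_distrib]
  exact Finset.sum_le_sum fun x _ => by simpa using abs_add_le (f.coeff x) (g.coeff x)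

theorem l1_smul (c : ℝ) (f : AddMonoidAlgebra ℝ G) : l1 (c • f) = |c| * l1 f := by
  have h : (c • f).coeff.support ⊆ f.coeff.support := by
    rw [coeff_smul]; exact Finsupp.support_smul
  rw [l1_eq_sum h, l1, Finset.mul_sum]
  exact Finset.sum_congr rfl fun x _ => by simp [abs_mul]

@[simp] theorem l1_zero : l1 (0 : AddMonoidAlgebra ℝ G) = 0 := by simp [l1]

theorem l1_single (x : G) (r : ℝ) : l1 (single x r) = |r| := by
  classical
  rw [l1_eq_sum (s := {x}) (by simpa using Finsupp.support_single_subset)]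
  simp

theorem l1_sum_le {ι : Type*} (s : Finset ι) (f : ι → AddMonoidAlgebra ℝ G) :
    l1 (∑ i ∈ s, f i) ≤ ∑ i ∈ s, l1 (f i) :=
  Finset.le_sum_of_subadditive l1 l1_zero.le l1_add_le s f

theorem abs_coeff_le_l1 (f : AddMonoidAlgebra ℝ G) (x : G) : |f.coeff x| ≤ l1 f := by
  by_cases hx : x ∈ f.coeff.support
  · exact Finset.single_le_sum (f := fun x => |f.coeff x|) (fun _ _ => abs_nonneg _) hx
  · have : f.coeff x = 0 := by simpa using hx
    simpa [this] using l1_nonneg f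

theorem abs_pairing_le {h : G → ℝ} (hh : ∀ x, |h x| ≤ 1) (f : AddMonoidAlgebra ℝ G) :
    |pairing h f| ≤ l1 f := by
  rw [pairing_eq_sum]
  refine (Finset.abs_sum_le_sum_abs _ _).trans (Finset.sum_le_sum fun x _ => ?_)
  rw [abs_mul]
  exact mul_le_of_le_one_right (abs_nonneg _) (hh x)

theorem l1_map_le (T : AddMonoidAlgebra ℝ G →ₗ[ℝ] AddMonoidAlgebra ℝ H) {M : ℝ}
    (hT : ∀ x, l1 (T (single x 1)) ≤ M) (f : AddMonoidAlgebra ℝ G) : l1 (T f) ≤ M * l1 f := by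
  have hf : f = ∑ x ∈ f.coeff.support, f.coeff x • single x (1 : ℝ) := by
    conv_lhs => rw [← sum_coeff_single f]
    simp [Finsupp.sum]
  conv_lhs => rw [hf, map_sum]
  refine (l1_sum_le _ _).trans ?_
  rw [l1, Finset.mul_sum]
  refine Finset.sum_le_sum fun x _ => ?_
  rw [map_smul, l1_smul, mul_comm]
  exact mul_le_mul_of_nonneg_right (hT x) (abs_nonneg _)

theorem coeff_single_nonneg (x : G) {r : ℝ} (hr : 0 ≤ r) (y : G) :
    0 ≤ (single x r).coeff y := by
  classical
  rw [coeff_single, Finsupp.single_apply]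
  split_ifs <;> simp [hr]

theorem l1_eq_pairing_of_nonneg {f : AddMonoidAlgebra ℝ G} (hf : ∀ x, 0 ≤ f.coeff x) :
    l1 f = pairing (fun _ => 1) f := by
  rw [l1, pairing_eq_sum]
  exact Finset.sum_congr rfl fun x _ => by rw [abs_of_nonneg (hf x), mul_one]

variable [AddCommGroup G] [AddCommGroup H]

theorem l1_mul_le (f g : AddMonoidAlgebra ℝ G) : l1 (f * g) ≤ l1 f * l1 g := by
  have h := l1_map_le (LinearMap.mulRight ℝ g) (M := l1 g) (fun x => ?_) f
  · simpa [mul_comm] using h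
  · simpa using l1_map_le (LinearMap.mulLeft ℝ (single x (1 : ℝ))) (M := 1)
      (fun y => by simp [single_mul_single, l1_single]) g

theorem l1_mapDomain_le (φ : G →+ H) (f : AddMonoidAlgebra ℝ G) :
    l1 (mapDomainAlgHom ℝ ℝ φ f) ≤ l1 f := by
  simpa using l1_map_le (mapDomainAlgHom ℝ ℝ φ).toLinearMap (M := 1)
    (fun y => by simp [l1_single]) f

theorem pairing_one_mul (f g : AddMonoidAlgebra ℝ G) :
    pairing (fun _ => 1) (f * g) = pairing (fun _ => 1) f * pairing (fun _ => 1) g := by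
  induction f using AddMonoidAlgebra.induction_linear with
  | zero => simp
  | add x y hx hy => simp [add_mul, hx, hy]
  | single m r =>
    induction g using AddMonoidAlgebra.induction_linear with
    | zero => simp
    | add x y hx hy => simp only [mul_add, map_add, hx, hy]
    | single m' r' => simp [single_mul_single]

/-- Expansion of `(χ x + χ y) ^ 2`: the second moment of a sum of independent steps. -/
theorem pairing_sq_char_mul (χ : G →+ ℝ) (f g : AddMonoidAlgebra ℝ G) :
    pairing (fun x => χ x ^ 2) (f * g) = pairing (fun x => χ x ^ 2) f * pairing (fun _ => 1) g +
      2 * (pairing χ f * pairing χ g) +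
      pairing (fun _ => 1) f * pairing (fun x => χ x ^ 2) g := by
  induction f using AddMonoidAlgebra.induction_linear with
  | zero => simp
  | add x y hx hy => simp only [add_mul, map_add, hx, hy]; ring
  | single m r =>
    induction g using AddMonoidAlgebra.induction_linear with
    | zero => simp
    | add x y hx hy => simp only [mul_add, map_add, hx, hy]; ring
    | single m' r' => simp [single_mul_single]; ring

theorem pairing_one_pow (f : AddMonoidAlgebra ℝ G) (n : ℕ) :
    pairing (fun _ => 1) (f ^ n) = pairing (fun _ => 1) f ^ n := by
  induction n with
  | zero => simp [one_def]
  | succ n ih => rw [pow_succ, pairing_one_mul, ih, pow_succ]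

theorem pairing_sq_char_pow {χ : G →+ ℝ} {f : AddMonoidAlgebra ℝ G}
    (h1 : pairing (fun _ => 1) f = 1) (h0 : pairing χ f = 0) (n : ℕ) :
    pairing (fun x => χ x ^ 2) (f ^ n) = n * pairing (fun x => χ x ^ 2) f := by
  induction n with
  | zero => simp [one_def]
  | succ n ih =>
    rw [pow_succ, pairing_sq_char_mul, ih, h0, pairing_one_pow, h1]; push_cast; ring

theorem coeff_mul_nonneg {f g : AddMonoidAlgebra ℝ G} (hf : ∀ x, 0 ≤ f.coeff x)
    (hg : ∀ x, 0 ≤ g.coeff x) (x : G) : 0 ≤ (f * g).coeff x := by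
  classical
  rw [coeff_mul]
  refine Finset.sum_nonneg fun y _ => Finset.sum_nonneg fun z _ => ?_
  dsimp only
  split_ifs
  · exact mul_nonneg (hf y) (hg z)
  · exact le_rfl

theorem coeff_pow_nonneg {f : AddMonoidAlgebra ℝ G} (hf : ∀ x, 0 ≤ f.coeff x) (n : ℕ) :
    ∀ x, 0 ≤ (f ^ n).coeff x := by
  induction n with
  | zero => simpa [one_def] using fun x => coeff_single_nonneg (0 : G) zero_le_one x
  | succ n ih => rw [pow_succ]; exact coeff_mul_nonneg ih hf

/-- Multiplication by an additive character, as a linear map. -/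
def charMul (χ : G →+ ℝ) : AddMonoidAlgebra ℝ G →ₗ[ℝ] AddMonoidAlgebra ℝ G :=
  (Finsupp.lsum ℝ fun x => χ x • (lsingle x : ℝ →ₗ[ℝ] AddMonoidAlgebra ℝ G)) ∘ₗ
    (coeffLinearEquiv ℝ).toLinearMap

theorem charMul_single (χ : G →+ ℝ) (x : G) (r : ℝ) :
    charMul χ (single x r) = single x (χ x * r) := by
  simp only [charMul, LinearMap.comp_apply, LinearEquiv.coe_coe, coeffLinearEquiv_apply,
    coeff_single, Finsupp.lsum_single, LinearMap.smul_apply, lsingle_apply, smul_single,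
    smul_eq_mul]

/-- Multiplication by an additive character, as a derivation of the group algebra. -/
def charDerivation (χ : G →+ ℝ) : Derivation ℝ (AddMonoidAlgebra ℝ G) (AddMonoidAlgebra ℝ G) :=
  Derivation.mk' (charMul χ) (by
    intro f g
    simp only [smul_eq_mul]
    induction f using AddMonoidAlgebra.induction_linear with
    | zero => simp
    | add x y hx hy => simp only [add_mul, mul_add, map_add, hx, hy]; abel
    | single m r =>
      induction g using AddMonoidAlgebra.induction_linear with
      | zero => simp
      | add x y hx hy => simp only [add_mul, mul_add, map_add, hx, hy]; abel
      | single m' r' =>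
        simp only [single_mul_single, charMul_single, map_add, add_comm m' m, ← single_add]
        congr 1; ring)

@[simp] theorem charDerivation_single (χ : G →+ ℝ) (x : G) (r : ℝ) :
    charDerivation χ (single x r) = single x (χ x * r) := charMul_single χ x r

theorem coeff_charDerivation (χ : G →+ ℝ) (f : AddMonoidAlgebra ℝ G) (x : G) :
    (charDerivation χ f).coeff x = χ x * f.coeff x := by
  classical
  induction f using AddMonoidAlgebra.induction_linear with
  | zero => simp
  | add f g hf hg => simp [hf, hg, mul_add]
  | single m r =>
    simp only [charDerivation_single, coeff_single, Finsupp.single_apply]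
    split_ifs with h <;> simp [h]

/-- Cauchy–Schwarz: the first absolute moment is controlled by the second moment and the total mass.
-/
theorem l1_charDerivation_sq_le {χ : G →+ ℝ} {f : AddMonoidAlgebra ℝ G}
    (hf : ∀ x, 0 ≤ f.coeff x) :
    l1 (charDerivation χ f) ^ 2 ≤ pairing (fun x => χ x ^ 2) f * pairing (fun _ => 1) f := by
  have h : (charDerivation χ f).coeff.support ⊆ f.coeff.support := fun x hx => by
    simp only [Finsupp.mem_support_iff, coeff_charDerivation] at hx ⊢
    exact right_ne_zero_of_mul hx
  rw [l1_eq_sum h, pairing_eq_sum, pairing_eq_sum]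
  refine Finset.sum_sq_le_sum_mul_sum_of_sq_le_mul _ (fun x _ => ?_) (fun x _ => ?_) (fun x _ => ?_)
  · exact mul_nonneg (hf x) (sq_nonneg _)
  · simpa using hf x
  · rw [sq_abs, coeff_charDerivation]; exact le_of_eq (by ring)

/-- A convolution power of a probability measure charging `0` and `a` is nearly invariant under the
translation by `a`. -/
theorem l1_one_sub_single_mul_pow_le {q r : AddMonoidAlgebra ℝ G} {a : G} {β : ℝ} (hβ : 0 < β)
    (hr : ∀ x, 0 ≤ r.coeff x) (hq : q = single 0 (β / 2) + single a (β / 2) + r)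
    (h1 : pairing (fun _ => 1) q = 1) (n : ℕ) :
    l1 ((1 - single a 1) * q ^ n) ≤ 2 / √β / √((n : ℝ) + 1) := by
  -- The walk is lifted to `G × ℤ`: the extra integer records a fair sign, `-1` for a step `0` and
  -- `+1` for a step `a` taken from the split-off masses `β / 2`, and is unchanged by the steps of
  -- `r`. Forgetting the integer recovers `q`.
  let χ : G × ℤ →+ ℝ := (Int.castAddHom ℝ).comp (AddMonoidHom.snd G ℤ)
  let π := mapDomainAlgHom ℝ ℝ (AddMonoidHom.fst G ℤ)
  let ι := mapDomainAlgHom ℝ ℝ (AddMonoidHom.inl G ℤ)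
  have hπι : ∀ f, π (ι f) = f := fun f => by
    induction f using AddMonoidAlgebra.induction_linear with
    | zero => simp
    | add f g hf hg => simp [hf, hg]
    | single m s => simp [π, ι]
  have hpι : ∀ f, pairing (fun _ => 1) (ι f) = pairing (fun _ => 1) f := fun f => by
    induction f using AddMonoidAlgebra.induction_linear with
    | zero => simp
    | add f g hf hg => simp [hf, hg]
    | single m s => simp [ι]
  have hχι : ∀ f, pairing χ (ι f) = 0 := fun f => by
    induction f using AddMonoidAlgebra.induction_linear with
    | zero => simp
    | add f g hf hg => simp [hf, hg]
    | single m s => simp [ι, χ]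
  have hχχι : ∀ f, pairing (fun x => χ x ^ 2) (ι f) = 0 := fun f => by
    induction f using AddMonoidAlgebra.induction_linear with
    | zero => simp
    | add f g hf hg => simp [hf, hg]
    | single m s => simp [ι, χ]
  have hDι : ∀ f, charDerivation χ (ι f) = 0 := fun f => by
    induction f using AddMonoidAlgebra.induction_linear with
    | zero => simp
    | add f g hf hg => simp [hf, hg]
    | single m s => simp [ι, χ]
  have hιnn : ∀ x, 0 ≤ (ι r).coeff x := by
    have : ι r = ∑ x ∈ r.coeff.support, single (x, 0) (r.coeff x) := by
      conv_lhs => rw [← sum_coeff_single r]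
      simp [Finsupp.sum, ι]
    intro x
    rw [this, coeff_sum, Finsupp.finsetSum_apply]
    exact Finset.sum_nonneg fun y _ => coeff_single_nonneg _ (hr y) x
  let w : AddMonoidAlgebra ℝ (G × ℤ) := single (0, -1) (β / 2) + single (a, 1) (β / 2) + ι r
  have hwnn : ∀ x, 0 ≤ w.coeff x := fun x => by
    simp only [w, coeff_add, Finsupp.add_apply]
    have h2 : 0 ≤ β / 2 := by positivity
    exact add_nonneg (add_nonneg (coeff_single_nonneg _ h2 x) (coeff_single_nonneg _ h2 x)) (hιnn x)
  have hπw : π w = q := by simp only [w, map_add, hπι, hq]; simp [π]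
  have hw1 : pairing (fun _ => 1) w = 1 := by
    rw [hq] at h1
    simpa only [w, map_add, hpι, pairing_single] using h1
  have hw0 : pairing χ w = 0 := by
    simp only [w, map_add, hχι, pairing_single]; simp [χ]
  have hw2 : pairing (fun x => χ x ^ 2) w = β := by
    simp only [w, map_add, hχχι, pairing_single]; simp [χ]
  have hDw : charDerivation χ w = single (0, -1) (-(β / 2)) + single (a, 1) (β / 2) := by
    simp only [w, map_add, hDι, charDerivation_single]; simp [χ]
  -- By Leibniz, the derivation of `w ^ (n + 1)` is `n + 1` times `w ^ n` times the signed measure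
  -- that puts opposite masses on `0` and `a`; projected to `G` this is the translation difference
  -- to be bounded.
  have hD : π (charDerivation χ (w ^ (n + 1))) =
      (-(((n : ℝ) + 1) * (β / 2))) • ((1 - single a 1) * q ^ n) := by
    rw [Derivation.leibniz_pow, hDw]
    simp only [Nat.add_sub_cancel, smul_eq_mul, map_nsmul, map_mul, map_pow, hπw, map_add]
    have h3 : π (single (0, -1) (-(β / 2))) + π (single (a, 1) (β / 2)) =
        (-(β / 2)) • (1 - single a 1) := by
      have hπs : ∀ x r, π (single x r) = single x.1 r := fun x r => by simp [π]
      rw [hπs, hπs, one_def, smul_sub, smul_single, smul_single, smul_eq_mul, mul_one,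
        sub_eq_add_neg, ← single_neg, neg_neg]
    rw [h3, ← Nat.cast_smul_eq_nsmul ℝ, mul_smul_comm, smul_smul, mul_comm (q ^ n)]
    push_cast
    congr 1; ring
  have hn : (0 : ℝ) < n + 1 := by positivity
  -- The recorded integer is a centred walk of variance `β` per step, so its absolute value has mean
  -- at most the square root of `(n + 1) * β`. Dividing by `(n + 1) * β / 2` gives the claim.
  have hb : l1 (charDerivation χ (w ^ (n + 1))) ≤ √(((n : ℝ) + 1) * β) := by
    refine Real.le_sqrt_of_sq_le ((l1_charDerivation_sq_le (coeff_pow_nonneg hwnn _)).trans ?_)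
    rw [pairing_sq_char_pow hw1 hw0, hw2, pairing_one_pow, hw1]
    simp
  have h4 := (l1_mapDomain_le (AddMonoidHom.fst G ℤ) (charDerivation χ (w ^ (n + 1)))).trans hb
  change l1 (π _) ≤ _ at h4
  rw [hD, l1_smul, abs_neg, abs_of_pos (by positivity), Real.sqrt_mul hn.le] at h4
  have hs1 := Real.sqrt_pos.2 hn
  have hs2 := Real.sqrt_pos.2 hβ
  rw [le_div_iff₀ hs1, le_div_iff₀ hs2]
  have e1 : √((n : ℝ) + 1) * √((n : ℝ) + 1) = n + 1 := Real.mul_self_sqrt hn.le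
  have e2 : √β * √β = β := Real.mul_self_sqrt hβ.le
  have h5 : √((n : ℝ) + 1) * √β * (l1 ((1 - single a 1) * q ^ n) * √((n : ℝ) + 1) * √β) ≤
      √((n : ℝ) + 1) * √β * 2 := by
    calc _ = (√((n : ℝ) + 1) * √((n : ℝ) + 1)) * (√β * √β) * l1 ((1 - single a 1) * q ^ n) := by ring
      _ = 2 * (((n : ℝ) + 1) * (β / 2) * l1 ((1 - single a 1) * q ^ n)) := by rw [e1, e2]; ring
      _ ≤ 2 * (√((n : ℝ) + 1) * √β) := by gcongr
      _ = _ := by ring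
  exact le_of_mul_le_mul_left h5 (by positivity)

end GroupAlgebra

/-! ### Heat kernel bounds for the lazy walk on `ℤ³`, in time and in space. -/

section LazyWalk

open AddMonoidAlgebra

/-- The nearest neighbours of the origin in `ℤ³`. -/
def units : Finset (Site 3) := (Finset.Icc (-1) 1).filter fun y => ∑ k, |y k| = 1

theorem mem_units {y : Site 3} : y ∈ units ↔ ∑ k, |y k| = 1 := by
  simp only [units, Finset.mem_filter, Finset.mem_Icc, and_iff_right_iff_imp]
  intro h
  have hk : ∀ k, |y k| ≤ 1 := fun k => h ▸ Finset.single_le_sum (f := fun k => |y k|)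
    (fun _ _ => abs_nonneg _) (Finset.mem_univ k)
  exact ⟨fun k => (abs_le.1 (hk k)).1, fun k => (abs_le.1 (hk k)).2⟩

theorem card_units : units.card = 6 := by decide +kernel

theorem neg_mem_units {y : Site 3} : -y ∈ units ↔ y ∈ units := by simp [mem_units]

theorem zero_notMem_units : (0 : Site 3) ∉ units := by simp [mem_units]

theorem single_mem_units (k : Fin 3) : (Pi.single k 1 : Site 3) ∈ units := by
  rw [mem_units, Finset.sum_eq_single k] <;> simp +contextual

theorem sum_units_apply (k : Fin 3) : ∑ y ∈ units, ((y k : ℤ) : ℝ) = 0 := by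
  have h : ∑ y ∈ units, ((y k : ℤ) : ℝ) = ∑ y ∈ units, -((y k : ℤ) : ℝ) :=
    Finset.sum_nbij' (fun y => -y) (fun y => -y) (fun y hy => neg_mem_units.2 hy)
      (fun y hy => neg_mem_units.2 hy) (by simp) (by simp) (by simp)
  rw [Finset.sum_neg_distrib] at h
  linarith

/-- The transition kernel of the lazy simple random walk, as an element of the group algebra. -/
def lazyWalk : AddMonoidAlgebra ℝ (Site 3) := single 0 (1 / 2) + ∑ y ∈ units, single y (1 / 12)

theorem pairing_one_lazyWalk : pairing (fun _ => 1) lazyWalk = 1 := by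
  simp [lazyWalk, card_units]; norm_num

theorem coeff_lazyWalk_nonneg (x : Site 3) : 0 ≤ lazyWalk.coeff x := by
  rw [lazyWalk, coeff_add, coeff_sum, Finsupp.add_apply, Finsupp.finsetSum_apply]
  exact add_nonneg (coeff_single_nonneg _ (by norm_num) _)
    (Finset.sum_nonneg fun y _ => coeff_single_nonneg _ (by norm_num) _)

theorem l1_lazyWalk_pow (n : ℕ) : l1 (lazyWalk ^ n) = 1 := by
  rw [l1_eq_pairing_of_nonneg (coeff_pow_nonneg coeff_lazyWalk_nonneg n), pairing_one_pow,
    pairing_one_lazyWalk, one_pow]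

/-- Laziness makes both `0` and `a` atoms of the one-step law: mass `1 / 12` is taken from each, so
`β = 1 / 6`. -/
theorem l1_unit_gradient_le {a : Site 3} (ha : a ∈ units) (n : ℕ) :
    l1 ((1 - single a 1) * lazyWalk ^ n) ≤ 2 / √(1 / 6) / √((n : ℝ) + 1) := by
  refine l1_one_sub_single_mul_pow_le
    (r := single 0 (5 / 12) + ∑ y ∈ units.erase a, single y (1 / 12)) (by norm_num)
    (fun x => ?_) ?_ pairing_one_lazyWalk n
  · rw [coeff_add, coeff_sum, Finsupp.add_apply, Finsupp.finsetSum_apply]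
    exact add_nonneg (coeff_single_nonneg _ (by norm_num) _)
      (Finset.sum_nonneg fun y _ => coeff_single_nonneg _ (by norm_num) _)
  · rw [lazyWalk, ← Finset.add_sum_erase units _ ha]
    have h : (single 0 (1 / 2) : AddMonoidAlgebra ℝ (Site 3)) =
        single 0 (1 / 6 / 2) + single 0 (5 / 12) := by
      rw [← single_add]; norm_num
    rw [h, show (1 / 6 / 2 : ℝ) = 1 / 12 by norm_num]
    abel

/-- `f` behaves like a finite difference operator of order `k` on the lazy walk. -/
def DecaysAtOrder (k : ℕ) (f : AddMonoidAlgebra ℝ (Site 3)) : Prop :=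
  ∃ C : ℝ, ∀ n : ℕ, l1 (f * lazyWalk ^ n) ≤ C / √((n : ℝ) + 1) ^ k

theorem decaysAtOrder_zero (f : AddMonoidAlgebra ℝ (Site 3)) : DecaysAtOrder 0 f :=
  ⟨l1 f, fun n => by simpa [l1_lazyWalk_pow] using l1_mul_le f (lazyWalk ^ n)⟩

theorem decaysAtOrder_unit {a : Site 3} (ha : a ∈ units) :
    DecaysAtOrder 1 (1 - single a 1) :=
  ⟨_, fun n => by simpa using l1_unit_gradient_le ha n⟩

theorem DecaysAtOrder.add {k : ℕ} {f g : AddMonoidAlgebra ℝ (Site 3)} (hf : DecaysAtOrder k f)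
    (hg : DecaysAtOrder k g) : DecaysAtOrder k (f + g) := by
  obtain ⟨C, hC⟩ := hf
  obtain ⟨D, hD⟩ := hg
  refine ⟨C + D, fun n => ?_⟩
  rw [add_mul, add_div]
  exact (l1_add_le _ _).trans (add_le_add (hC n) (hD n))

theorem DecaysAtOrder.smul {k : ℕ} {f : AddMonoidAlgebra ℝ (Site 3)} (hf : DecaysAtOrder k f)
    (c : ℝ) : DecaysAtOrder k (c • f) := by
  obtain ⟨C, hC⟩ := hf
  refine ⟨|c| * C, fun n => ?_⟩
  rw [smul_mul_assoc, l1_smul, mul_div_assoc]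
  exact mul_le_mul_of_nonneg_left (hC n) (abs_nonneg _)

theorem DecaysAtOrder.sum {k : ℕ} {ι : Type*} {s : Finset ι} {f : ι → AddMonoidAlgebra ℝ (Site 3)}
    (hf : ∀ i ∈ s, DecaysAtOrder k (f i)) : DecaysAtOrder k (∑ i ∈ s, f i) :=
  Finset.sum_induction f _ (fun _ _ => .add) ⟨0, fun n => by simp⟩ hf

/-- Half of the time is given to each factor, and the two `ℓ¹` bounds are multiplied; each half
costs only a factor `√2` per order. -/
theorem DecaysAtOrder.mul {j k : ℕ} {f g : AddMonoidAlgebra ℝ (Site 3)} (hf : DecaysAtOrder j f)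
    (hg : DecaysAtOrder k g) : DecaysAtOrder (j + k) (f * g) := by
  obtain ⟨C, hC⟩ := hf
  obtain ⟨D, hD⟩ := hg
  have hC0 : 0 ≤ C := (l1_nonneg _).trans (by simpa using hC 0)
  have hD0 : 0 ≤ D := (l1_nonneg _).trans (by simpa using hD 0)
  have key : ∀ {E : ℝ}, 0 ≤ E → ∀ {i m n : ℕ}, n ≤ 2 * m + 1 →
      E / √((m : ℝ) + 1) ^ i ≤ E * √2 ^ i / √((n : ℝ) + 1) ^ i := by
    intro E hE i m n h
    have h1 : 0 < √((m : ℝ) + 1) := Real.sqrt_pos.2 (by positivity)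
    have h2 : 0 < √((n : ℝ) + 1) := Real.sqrt_pos.2 (by positivity)
    have h3 : √((n : ℝ) + 1) ≤ √2 * √((m : ℝ) + 1) := by
      rw [← Real.sqrt_mul (by norm_num)]
      refine Real.sqrt_le_sqrt ?_
      have : (n : ℝ) ≤ 2 * m + 1 := by exact_mod_cast h
      linarith
    rw [div_le_div_iff₀ (by positivity) (by positivity), mul_assoc, ← mul_pow]
    gcongr
  refine ⟨C * √2 ^ j * (D * √2 ^ k), fun n => ?_⟩
  have hn : f * g * lazyWalk ^ n = f * lazyWalk ^ (n / 2) * (g * lazyWalk ^ (n - n / 2)) := by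
    conv_lhs => rw [show n = n / 2 + (n - n / 2) by omega, pow_add]
    ring
  rw [hn, pow_add, mul_div_mul_comm]
  exact (l1_mul_le _ _).trans (mul_le_mul ((hC _).trans (key hC0 (by omega)))
    ((hD _).trans (key hD0 (by omega))) (l1_nonneg _) (by positivity))

theorem pairing_one_sub_single_mul {G : Type*} [AddCommGroup G] (h : G → ℝ) (e : G)
    (f : AddMonoidAlgebra ℝ G) :
    pairing h ((1 - single e 1) * f) = pairing (fun x => h x - h (e + x)) f := by
  induction f using AddMonoidAlgebra.induction_linear with
  | zero => simp
  | add f g hf hg => simp [mul_add, hf, hg]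
  | single m r => simp [sub_mul, single_mul_single, mul_sub]

/-- The third order difference operator in the three coordinate directions. -/
def mixedGradient : AddMonoidAlgebra ℝ (Site 3) :=
  (1 - single (Pi.single 0 1) 1) * ((1 - single (Pi.single 1 1) 1) * (1 - single (Pi.single 2 1) 1))

theorem decaysAtOrder_mixedGradient : DecaysAtOrder 3 mixedGradient :=
  (decaysAtOrder_unit (single_mem_units 0)).mul
    ((decaysAtOrder_unit (single_mem_units 1)).mul (decaysAtOrder_unit (single_mem_units 2)))

/-- A discrete Sobolev inequality: `‖f‖_∞ ≤ ‖∂₁∂₂∂₃ f‖₁`. -/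
theorem abs_coeff_le_l1_mixedGradient (f : AddMonoidAlgebra ℝ (Site 3)) (z : Site 3) :
    |f.coeff z| ≤ l1 (mixedGradient * f) := by
  have h1 : f.coeff z = pairing (fun x => if x = z then 1 else 0) f := by
    rw [pairing_eq_sum]
    simp +contextual [Finset.sum_ite_eq']
  have h2 : (fun x => if x = z then (1 : ℝ) else 0) = fun x : Site 3 =>
      if x 0 = z 0 ∧ x 1 = z 1 ∧ x 2 = z 2 then 1 else 0 := by
    funext x
    simp [funext_iff, Fin.forall_fin_succ]
  -- Summation by parts against the indicator of the octant below `z`: each unit difference turns a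
  -- half-line indicator into a point indicator, so three of them leave the point mass at `z`.
  have h3 : pairing (fun x : Site 3 => (if x 0 ≤ z 0 then (1 : ℝ) else 0) *
      (if x 1 ≤ z 1 then 1 else 0) * (if x 2 ≤ z 2 then 1 else 0)) (mixedGradient * f) =
      f.coeff z := by
    rw [mixedGradient, mul_assoc, mul_assoc, pairing_one_sub_single_mul,
      pairing_one_sub_single_mul, pairing_one_sub_single_mul, h1, h2]
    congr 2
    funext x
    have e : ∀ s t : ℤ, (if 1 + s ≤ t then (1 : ℝ) else 0) =
        (if s ≤ t then 1 else 0) - (if s = t then 1 else 0) := fun s t => by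
      split_ifs <;> first | omega | norm_num
    simp only [Pi.add_apply, Pi.single_apply, Fin.isValue, Fin.reduceEq, if_true, if_false,
      zero_add, e, ite_and]
    split_ifs <;> norm_num
  rw [← h3]
  refine abs_pairing_le (fun x => ?_) _
  split_ifs <;> simp

/-- The three differences of the Sobolev inequality add three orders of decay, which is the usual
`n^(-3/2)` of dimension three. -/
theorem DecaysAtOrder.abs_coeff_le {k : ℕ} {f : AddMonoidAlgebra ℝ (Site 3)}
    (hf : DecaysAtOrder k f) :
    ∃ C : ℝ, ∀ (n : ℕ) (z : Site 3),
      |(f * lazyWalk ^ n).coeff z| ≤ C / √((n : ℝ) + 1) ^ (3 + k) := by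
  obtain ⟨C, hC⟩ := decaysAtOrder_mixedGradient.mul hf
  refine ⟨C, fun n z => (abs_coeff_le_l1_mixedGradient _ z).trans ?_⟩
  rw [← mul_assoc]
  exact hC n

/-- The `k`-th coordinate, as an additive character of the lattice. -/
def coordChar (k : Fin 3) : Site 3 →+ ℝ := (Int.castAddHom ℝ).comp (Pi.evalAddMonoidHom _ k)

@[simp] theorem coordChar_apply (k : Fin 3) (x : Site 3) : coordChar k x = x k := rfl

/-- Since the steps are centred, the coordinate-weighted one-step law has total mass zero and is a
combination of unit gradients. -/
theorem decaysAtOrder_charDerivation_lazyWalk (k : Fin 3) :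
    DecaysAtOrder 1 (charDerivation (coordChar k) lazyWalk) := by
  have h : charDerivation (coordChar k) lazyWalk =
      ∑ y ∈ units, (-((y k : ℝ) / 12)) • ((1 : AddMonoidAlgebra ℝ (Site 3)) - single y 1) := by
    simp only [smul_sub, Finset.sum_sub_distrib, ← Finset.sum_smul, Finset.sum_neg_distrib,
      ← Finset.sum_div, sum_units_apply]
    simp [lazyWalk, div_eq_mul_inv]
  rw [h]
  exact DecaysAtOrder.sum fun y hy => (decaysAtOrder_unit hy).smul _

/-- The product of two discrete gradients. -/
def doubleGradient (a b : Site 3) : AddMonoidAlgebra ℝ (Site 3) :=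
  (1 - single a 1) * (1 - single b 1)

theorem decaysAtOrder_doubleGradient {a b : Site 3} (ha : a ∈ units) (hb : b ∈ units) :
    DecaysAtOrder 2 (doubleGradient a b) := (decaysAtOrder_unit ha).mul (decaysAtOrder_unit hb)

/-- Leibniz: differentiating one of the two gradients destroys its cancellation, and the other one
survives. -/
theorem decaysAtOrder_charDerivation_doubleGradient {a b : Site 3} (ha : a ∈ units)
    (hb : b ∈ units) (k : Fin 3) :
    DecaysAtOrder 1 (charDerivation (coordChar k) (doubleGradient a b)) := by
  rw [doubleGradient, Derivation.leibniz]
  exact ((decaysAtOrder_unit ha).mul (decaysAtOrder_zero _)).add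
    ((decaysAtOrder_unit hb).mul (decaysAtOrder_zero _))

/-- The power `n + 2` lets every term keep a factor `q ^ n`, with no truncated subtraction in
exponents. -/
theorem charDerivation_sq_mul_pow (χ : Site 3 →+ ℝ) (c q : AddMonoidAlgebra ℝ (Site 3)) (n : ℕ) :
    charDerivation χ (charDerivation χ (c * q ^ (n + 2))) =
      charDerivation χ (charDerivation χ c) * q ^ 2 * q ^ n +
      (2 * ((n : ℝ) + 2)) • (charDerivation χ c * charDerivation χ q * q * q ^ n) +
      (((n : ℝ) + 2) * (n + 1)) • (c * (charDerivation χ q * charDerivation χ q) * q ^ n) +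
      ((n : ℝ) + 2) • (c * charDerivation χ (charDerivation χ q) * q * q ^ n) := by
  have e : ∀ m : ℕ, charDerivation χ (q ^ (m + 1)) =
      algebraMap ℝ _ ((m : ℝ) + 1) * (q ^ m * charDerivation χ q) := fun m => by
    rw [Derivation.leibniz_pow, Nat.add_sub_cancel, ← Nat.cast_smul_eq_nsmul ℝ, smul_eq_mul,
      Algebra.smul_def]
    push_cast; rfl
  simp only [Derivation.leibniz, e (n + 1), smul_eq_mul, map_add, e n, Algebra.smul_def,
    Derivation.map_algebraMap, map_mul]
  push_cast
  simp only [map_ofNat]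
  ring

/-- The square of a coordinate times a second difference of the lazy walk. -/
theorem exists_coord_sq_mul_le {a b : Site 3} (ha : a ∈ units) (hb : b ∈ units) (k : Fin 3) :
    ∃ C : ℝ, ∀ (n : ℕ) (z : Site 3),
      (z k : ℝ) ^ 2 * |(doubleGradient a b * lazyWalk ^ n).coeff z| ≤ C / √((n : ℝ) + 1) ^ 3 := by
  set D := charDerivation (coordChar k) with hD
  set c := doubleGradient a b with hc
  have hDq : DecaysAtOrder 1 (D lazyWalk) := decaysAtOrder_charDerivation_lazyWalk k
  have hDc : DecaysAtOrder 1 (D c) := decaysAtOrder_charDerivation_doubleGradient ha hb k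
  have hc2 : DecaysAtOrder 2 c := decaysAtOrder_doubleGradient ha hb
  have hg := decaysAtOrder_mixedGradient
  -- The four terms of the Leibniz expansion have orders 3, 5, 7 and 5 after the Sobolev gradients,
  -- against prefactors of size `1`, `n`, `n ^ 2` and `n`. Each is therefore of size `n^(-3/2)`.
  obtain ⟨C0, h0⟩ := hg.mul (decaysAtOrder_zero (D (D c) * lazyWalk ^ 2))
  obtain ⟨C1, h1⟩ := hg.mul ((hDc.mul hDq).mul (decaysAtOrder_zero lazyWalk))
  obtain ⟨C2, h2⟩ := hg.mul (hc2.mul (hDq.mul hDq))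
  obtain ⟨C3, h3⟩ := hg.mul ((hc2.mul (decaysAtOrder_zero (D (D lazyWalk)))).mul
    (decaysAtOrder_zero lazyWalk))
  have hsmall : ∀ n : ℕ, ∃ K : ℝ, 0 ≤ K ∧ ∀ z : Site 3,
      (z k : ℝ) ^ 2 * |(c * lazyWalk ^ n).coeff z| ≤ K / √((n : ℝ) + 1) ^ 3 := fun n => by
    have hs : 0 < √((n : ℝ) + 1) := Real.sqrt_pos.2 (by positivity)
    refine ⟨l1 (D (D (c * lazyWalk ^ n))) * √((n : ℝ) + 1) ^ 3,
      mul_nonneg (l1_nonneg _) (by positivity), fun z => ?_⟩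
    rw [mul_div_cancel_right₀ _ (by positivity)]
    refine le_trans (le_of_eq ?_) (abs_coeff_le_l1 _ z)
    rw [coeff_charDerivation, coeff_charDerivation, coordChar_apply, ← mul_assoc, abs_mul, ← sq,
      abs_of_nonneg (sq_nonneg (z k : ℝ))]
  obtain ⟨K0, hK0, hK0'⟩ := hsmall 0
  obtain ⟨K1, hK1, hK1'⟩ := hsmall 1
  have nn : ∀ {j : ℕ} {f : AddMonoidAlgebra ℝ (Site 3)} {C : ℝ},
      (∀ n : ℕ, l1 (f * lazyWalk ^ n) ≤ C / √((n : ℝ) + 1) ^ j) → 0 ≤ C := fun h =>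
    (l1_nonneg _).trans (by simpa using h 0)
  have n0 := nn h0
  have n1 := nn h1
  have n2 := nn h2
  have n3 := nn h3
  have hbig : ∀ (n : ℕ) (z : Site 3), (z k : ℝ) ^ 2 * |(c * lazyWalk ^ (n + 2)).coeff z| ≤
      (C0 + 4 * C1 + 2 * C2 + 2 * C3) / √((n : ℝ) + 1) ^ 3 := fun n z => by
    have hs : 0 < √((n : ℝ) + 1) := Real.sqrt_pos.2 (by positivity)
    have hss : √((n : ℝ) + 1) ^ 2 = n + 1 := Real.sq_sqrt (by positivity)
    have hle : (n : ℝ) + 2 ≤ 2 * √((n : ℝ) + 1) ^ 2 := by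
      rw [hss]; linarith [(Nat.cast_nonneg n : (0 : ℝ) ≤ n)]
    calc (z k : ℝ) ^ 2 * |(c * lazyWalk ^ (n + 2)).coeff z|
        = |(D (D (c * lazyWalk ^ (n + 2)))).coeff z| := by
          rw [coeff_charDerivation, coeff_charDerivation, coordChar_apply, ← mul_assoc, abs_mul,
            ← sq, abs_of_nonneg (sq_nonneg (z k : ℝ))]
      _ ≤ l1 (mixedGradient * D (D (c * lazyWalk ^ (n + 2)))) := abs_coeff_le_l1_mixedGradient _ z
      _ = l1 (mixedGradient * (D (D c) * lazyWalk ^ 2) * lazyWalk ^ n +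
            (2 * ((n : ℝ) + 2)) • (mixedGradient * (D c * D lazyWalk * lazyWalk) * lazyWalk ^ n) +
            (((n : ℝ) + 2) * (n + 1)) •
              (mixedGradient * (c * (D lazyWalk * D lazyWalk)) * lazyWalk ^ n) +
            ((n : ℝ) + 2) •
              (mixedGradient * (c * D (D lazyWalk) * lazyWalk) * lazyWalk ^ n)) := by
          rw [hD, charDerivation_sq_mul_pow]
          simp only [mul_add, mul_smul_comm, mul_assoc]
      _ ≤ C0 / √((n : ℝ) + 1) ^ 3 + 2 * ((n : ℝ) + 2) * (C1 / √((n : ℝ) + 1) ^ 5) +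
            ((n : ℝ) + 2) * (n + 1) * (C2 / √((n : ℝ) + 1) ^ 7) +
            ((n : ℝ) + 2) * (C3 / √((n : ℝ) + 1) ^ 5) := by
          refine (l1_add_le _ _).trans (add_le_add ((l1_add_le _ _).trans (add_le_add
            ((l1_add_le _ _).trans (add_le_add (h0 n) ?_)) ?_)) ?_)
          · rw [l1_smul, abs_of_nonneg (by positivity)]
            exact mul_le_mul_of_nonneg_left (h1 n) (by positivity)
          · rw [l1_smul, abs_of_nonneg (by positivity)]
            exact mul_le_mul_of_nonneg_left (h2 n) (by positivity)
          · rw [l1_smul, abs_of_nonneg (by positivity)]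
            exact mul_le_mul_of_nonneg_left (h3 n) (by positivity)
      _ ≤ C0 / √((n : ℝ) + 1) ^ 3 +
            2 * (2 * √((n : ℝ) + 1) ^ 2) * (C1 / √((n : ℝ) + 1) ^ 5) +
            (2 * √((n : ℝ) + 1) ^ 2) * √((n : ℝ) + 1) ^ 2 * (C2 / √((n : ℝ) + 1) ^ 7) +
            (2 * √((n : ℝ) + 1) ^ 2) * (C3 / √((n : ℝ) + 1) ^ 5) := by
          have h5 := hss.ge
          gcongr
      _ = _ := by field_simp; ring
  -- `K0` and `K1` serve the times 0 and 1, outside the reach of the expansion. The factor 8 is the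
  -- cube of the 2 in `√(n + 3) ≤ 2 * √(n + 1)`.
  refine ⟨K0 + K1 + 8 * (C0 + 4 * C1 + 2 * C2 + 2 * C3), fun n z => ?_⟩
  match n with
  | 0 => exact (hK0' z).trans (by gcongr; linarith)
  | 1 => exact (hK1' z).trans (by gcongr; linarith)
  | n + 2 =>
    refine (hbig n z).trans ?_
    have hs : 0 < √((n : ℝ) + 1) := Real.sqrt_pos.2 (by positivity)
    have hs' : 0 < √(((n + 2 : ℕ) : ℝ) + 1) := Real.sqrt_pos.2 (by positivity)
    have h4 : √(((n + 2 : ℕ) : ℝ) + 1) ≤ 2 * √((n : ℝ) + 1) := by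
      rw [Real.sqrt_le_left (by positivity), mul_pow, Real.sq_sqrt (by positivity)]
      push_cast
      linarith [(Nat.cast_nonneg n : (0 : ℝ) ≤ n)]
    rw [div_le_div_iff₀ (by positivity) (by positivity)]
    calc _ ≤ (C0 + 4 * C1 + 2 * C2 + 2 * C3) * (2 * √((n : ℝ) + 1)) ^ 3 := by gcongr
      _ = 8 * (C0 + 4 * C1 + 2 * C2 + 2 * C3) * √((n : ℝ) + 1) ^ 3 := by ring
      _ ≤ _ := by gcongr; linarith

/-- Decay in time and space of the second differences of the lazy walk. -/
theorem exists_doubleGradient_bound : ∃ C : ℝ, 0 < C ∧ ∀ a ∈ units, ∀ b ∈ units,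
    ∀ (n : ℕ) (z : Site 3),
      |(doubleGradient a b * lazyWalk ^ n).coeff z| ≤ C / √((n : ℝ) + 1) ^ 5 ∧
      (∑ k, (z k : ℝ) ^ 2) * |(doubleGradient a b * lazyWalk ^ n).coeff z| ≤
        C / √((n : ℝ) + 1) ^ 3 := by
  have h : ∀ x : units × units, ∃ C : ℝ, 0 ≤ C ∧ ∀ (n : ℕ) (z : Site 3),
      |(doubleGradient x.1 x.2 * lazyWalk ^ n).coeff z| ≤ C / √((n : ℝ) + 1) ^ 5 ∧
      (∑ k, (z k : ℝ) ^ 2) * |(doubleGradient x.1 x.2 * lazyWalk ^ n).coeff z| ≤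
        C / √((n : ℝ) + 1) ^ 3 := fun x => by
    obtain ⟨C, hC⟩ := (decaysAtOrder_doubleGradient x.1.2 x.2.2).abs_coeff_le
    choose B hB using exists_coord_sq_mul_le x.1.2 x.2.2
    have hC0 : 0 ≤ C := (abs_nonneg _).trans (by simpa using hC 0 0)
    have hB0 : ∀ k, 0 ≤ B k := fun k =>
      le_of_eq_of_le (by simp) ((hB k 0 0).trans_eq (by simp))
    have hBs : 0 ≤ ∑ k, B k := Finset.sum_nonneg fun k _ => hB0 k
    refine ⟨C + ∑ k, B k, by positivity, fun n z => ⟨(hC n z).trans (by gcongr; linarith), ?_⟩⟩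
    rw [Finset.sum_mul]
    calc _ ≤ ∑ k, B k / √((n : ℝ) + 1) ^ 3 := Finset.sum_le_sum fun k _ => hB k n z
      _ = (∑ k, B k) / √((n : ℝ) + 1) ^ 3 := by rw [Finset.sum_div]
      _ ≤ _ := by gcongr; linarith
  choose C hC0 hC using h
  refine ⟨∑ x, C x + 1, by linarith [Finset.sum_nonneg fun x (_ : x ∈ Finset.univ) => hC0 x],
    fun a ha b hb n z => ?_⟩
  have hle : C (⟨a, ha⟩, ⟨b, hb⟩) ≤ ∑ x, C x + 1 :=
    (Finset.single_le_sum (fun x _ => hC0 x) (Finset.mem_univ _)).trans (by linarith)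
  obtain ⟨h1, h2⟩ := hC (⟨a, ha⟩, ⟨b, hb⟩) n z
  exact ⟨h1.trans (by gcongr), h2.trans (by gcongr)⟩

theorem exists_coeff_lazyWalk_pow_le :
    ∃ C : ℝ, ∀ (n : ℕ) (z : Site 3), |(lazyWalk ^ n).coeff z| ≤ C / √((n : ℝ) + 1) ^ 3 := by
  simpa using (decaysAtOrder_zero 1).abs_coeff_le

end LazyWalk

/-! ### Summing over time: bounds on products of Green gradients. -/

section Green

open AddMonoidAlgebra

theorem sum_range_sum_range_add_le {F : ℕ → ℝ} (hF : ∀ m, 0 ≤ F m) (n : ℕ) :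
    ∑ k ∈ Finset.range n, ∑ l ∈ Finset.range n, F (k + l) ≤
      ∑ m ∈ Finset.range (2 * n), ((m : ℝ) + 1) * F m := by
  rw [← Finset.sum_product', ← Finset.sum_fiberwise_of_maps_to (t := Finset.range (2 * n))
    (g := fun x : ℕ × ℕ => x.1 + x.2)]
  · refine Finset.sum_le_sum fun m _ => ?_
    have h : ∀ x ∈ (Finset.range n ×ˢ Finset.range n).filter (fun x => x.1 + x.2 = m),
        F (x.1 + x.2) = F m := fun x hx => by rw [(Finset.mem_filter.1 hx).2]
    rw [Finset.sum_congr rfl h, Finset.sum_const, nsmul_eq_mul]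
    refine mul_le_mul_of_nonneg_right ?_ (hF m)
    have hc : ((Finset.range n ×ˢ Finset.range n).filter (fun x => x.1 + x.2 = m)).card ≤ m + 1 := by
      rw [← Finset.Nat.card_antidiagonal m]
      exact Finset.card_le_card fun x hx => by simpa using (Finset.mem_filter.1 hx).2
    exact_mod_cast hc
  · intro x hx
    simp only [Finset.mem_product, Finset.mem_range] at hx ⊢
    omega

theorem sum_range_inv_sqrt_le (n : ℕ) : ∑ m ∈ Finset.range n, 1 / √((m : ℝ) + 1) ≤ 2 * √n := by
  induction n with
  | zero => simp
  | succ n ih =>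
    rw [Finset.sum_range_succ]
    push_cast
    have h0 : 0 ≤ √(n : ℝ) := Real.sqrt_nonneg _
    have h1 : 0 < √((n : ℝ) + 1) := Real.sqrt_pos.2 (by positivity)
    have e0 : √(n : ℝ) ^ 2 = n := Real.sq_sqrt (by positivity)
    have e1 : √((n : ℝ) + 1) ^ 2 = n + 1 := Real.sq_sqrt (by positivity)
    have h : 1 / √((n : ℝ) + 1) ≤ 2 * (√((n : ℝ) + 1) - √n) := by
      rw [div_le_iff₀ h1]
      nlinarith [sq_nonneg (√((n : ℝ) + 1) - √n)]
    linarith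

/-- Each term is at most the increment `2 / √x - 2 / √(x + 1)`, so the sum telescopes. -/
theorem sum_range_inv_sqrt_cube_le {N : ℕ} (hN : 0 < N) (n : ℕ) :
    ∑ i ∈ Finset.range n, 1 / √(((N + i : ℕ) : ℝ) + 1) ^ 3 ≤ 2 / √N - 2 / √((N + n : ℕ) : ℝ) := by
  induction n with
  | zero => simp
  | succ n ih =>
    rw [Finset.sum_range_succ]
    have hpos : (0 : ℝ) < ((N + n : ℕ) : ℝ) := by exact_mod_cast (by omega : 0 < N + n)
    have hc : ((N + (n + 1) : ℕ) : ℝ) = ((N + n : ℕ) : ℝ) + 1 := by push_cast; ring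
    rw [hc]
    set x : ℝ := ((N + n : ℕ) : ℝ)
    have h0 : 0 < √x := Real.sqrt_pos.2 hpos
    have h1 : 0 < √(x + 1) := Real.sqrt_pos.2 (by positivity)
    have e0 : √x ^ 2 = x := Real.sq_sqrt hpos.le
    have e1 : √(x + 1) ^ 2 = x + 1 := Real.sq_sqrt (by positivity)
    have hle : √x ≤ √(x + 1) := Real.sqrt_le_sqrt (by linarith)
    have h : 1 / √(x + 1) ^ 3 ≤ 2 / √x - 2 / √(x + 1) := by
      have e2 : 2 / √x - 2 / √(x + 1) = 2 / (√x * √(x + 1) * (√(x + 1) + √x)) := by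
        have : (√(x + 1) - √x) * (√(x + 1) + √x) = 1 := by linear_combination e1 - e0
        field_simp
        linarith
      rw [e2, div_le_div_iff₀ (by positivity) (by positivity)]
      calc 1 * (√x * √(x + 1) * (√(x + 1) + √x))
          ≤ 1 * (√(x + 1) * √(x + 1) * (√(x + 1) + √(x + 1))) := by gcongr
        _ = _ := by ring
    linarith

/-- The double sum is at most `∑ (m + 1) * F m`. Up to the diffusive time `R ^ 2` the spatial bound
gives terms of size `C / (R ^ 2 * √m)`, after it the temporal bound gives `C / m^(3/2)`; both ranges
contribute order `C / R`. -/
theorem sum_sum_add_mul_le {F : ℕ → ℝ} {C R : ℝ} (hF : ∀ m, 0 ≤ F m) (hR : 1 ≤ R)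
    (h1 : ∀ m : ℕ, F m ≤ C / √((m : ℝ) + 1) ^ 5)
    (h2 : ∀ m : ℕ, R ^ 2 * F m ≤ C / √((m : ℝ) + 1) ^ 3) (n : ℕ) :
    (∑ k ∈ Finset.range n, ∑ l ∈ Finset.range n, F (k + l)) * R ≤ 6 * C := by
  have hC : 0 ≤ C := (hF 0).trans (by simpa using h1 0)
  have hR0 : 0 < R := by linarith
  set g : ℕ → ℝ := fun m => ((m : ℝ) + 1) * F m with hg
  have hg0 : ∀ m, 0 ≤ g m := fun m => mul_nonneg (by positivity) (hF m)
  have hs : ∀ m : ℕ, 0 < √((m : ℝ) + 1) := fun m => Real.sqrt_pos.2 (by positivity)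
  have hss : ∀ m : ℕ, (m : ℝ) + 1 = √((m : ℝ) + 1) ^ 2 :=
    fun m => (Real.sq_sqrt (by positivity)).symm
  have hg1 : ∀ m, g m ≤ C * (1 / √((m : ℝ) + 1) ^ 3) := fun m => by
    calc g m ≤ √((m : ℝ) + 1) ^ 2 * (C / √((m : ℝ) + 1) ^ 5) := by
          rw [← hss]; exact mul_le_mul_of_nonneg_left (h1 m) (by positivity)
      _ = _ := by have := hs m; field_simp
  have hg2 : ∀ m, g m ≤ C / R ^ 2 * (1 / √((m : ℝ) + 1)) := fun m => by
    have h3 : F m ≤ C / √((m : ℝ) + 1) ^ 3 / R ^ 2 := by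
      rw [le_div_iff₀ (by positivity), mul_comm]; exact h2 m
    calc g m ≤ √((m : ℝ) + 1) ^ 2 * (C / √((m : ℝ) + 1) ^ 3 / R ^ 2) := by
          rw [← hss]; exact mul_le_mul_of_nonneg_left h3 (by positivity)
      _ = _ := by have := hs m; field_simp
  -- The cut between the two regimes. They contribute `4 * C / R` and `2 * C / R`, whence the
  -- constant 6.
  set N : ℕ := ⌈R ^ 2⌉₊
  have hN1 : R ^ 2 ≤ N := Nat.le_ceil _
  have hN2 : (N : ℝ) ≤ 2 ^ 2 * R ^ 2 := by
    have := (Nat.ceil_lt_add_one (sq_nonneg R)).le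
    nlinarith
  have hN0 : 0 < N := Nat.ceil_pos.2 (by positivity)
  have hsN1 : R ≤ √N := Real.le_sqrt_of_sq_le hN1
  have hsN2 : √N ≤ 2 * R := by
    rw [Real.sqrt_le_left (by positivity), mul_pow]; exact hN2
  have hsum : ∑ m ∈ Finset.range (2 * n), g m ≤ 6 * C / R := by
    calc ∑ m ∈ Finset.range (2 * n), g m ≤ ∑ m ∈ Finset.range (N + 2 * n), g m :=
          Finset.sum_le_sum_of_subset_of_nonneg (by simp) fun m _ _ => hg0 m
      _ = ∑ m ∈ Finset.range N, g m + ∑ i ∈ Finset.range (2 * n), g (N + i) :=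
          Finset.sum_range_add _ _ _
      _ ≤ ∑ m ∈ Finset.range N, C / R ^ 2 * (1 / √((m : ℝ) + 1)) +
            ∑ i ∈ Finset.range (2 * n), C * (1 / √(((N + i : ℕ) : ℝ) + 1) ^ 3) :=
          add_le_add (Finset.sum_le_sum fun m _ => hg2 m) (Finset.sum_le_sum fun m _ => hg1 _)
      _ ≤ C / R ^ 2 * (2 * (2 * R)) + C * (2 / R) := by
          rw [← Finset.mul_sum, ← Finset.mul_sum]
          refine add_le_add (mul_le_mul_of_nonneg_left ((sum_range_inv_sqrt_le N).trans (by gcongr))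
            (by positivity)) (mul_le_mul_of_nonneg_left
              ((sum_range_inv_sqrt_cube_le hN0 _).trans ?_) hC)
          have : 2 / √(N : ℝ) ≤ 2 / R := by gcongr
          have h0 : 0 ≤ 2 / √((N + 2 * n : ℕ) : ℝ) := by positivity
          linarith
      _ = 6 * C / R := by field_simp; ring
  have := (sum_range_sum_range_add_le hF n).trans hsum
  rwa [le_div_iff₀ hR0] at this

/-- The reflection of the group algebra. -/
def reflect : AddMonoidAlgebra ℝ (Site 3) →ₐ[ℝ] AddMonoidAlgebra ℝ (Site 3) :=
  mapDomainAlgHom ℝ ℝ (negAddMonoidHom : Site 3 →+ Site 3)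

@[simp] theorem reflect_single (x : Site 3) (r : ℝ) : reflect (single x r) = single (-x) r := by
  simp [reflect]

theorem reflect_lazyWalk : reflect lazyWalk = lazyWalk := by
  rw [lazyWalk, map_add, map_sum]
  simp only [reflect_single, neg_zero]
  congr 1
  exact Finset.sum_nbij' (fun y => -y) (fun y => -y) (fun y hy => neg_mem_units.2 hy)
    (fun y hy => neg_mem_units.2 hy) (by simp) (by simp) (by simp)

/-- The gradient, in the direction `a`, of the Green function of the lazy walk, restricted to the
times in `s`. -/
def greenGradient (a : Site 3) (s : Finset ℕ) : AddMonoidAlgebra ℝ (Site 3) :=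
  (1 / 2 : ℝ) • ((1 - single a 1) * ∑ k ∈ s, lazyWalk ^ k)

/-- The walk is symmetric, so reflection only reverses the direction of the second gradient, and the
two powers of the walk combine. -/
theorem greenGradient_mul_reflect (a b : Site 3) (s t : Finset ℕ) :
    greenGradient a s * reflect (greenGradient b t) =
      (1 / 4 : ℝ) • ∑ k ∈ s, ∑ l ∈ t, doubleGradient a (-b) * lazyWalk ^ (k + l) := by
  have h : reflect (1 - single b 1) = 1 - single (-b) 1 := by simp
  simp only [greenGradient, map_smul, map_mul, h, map_sum, map_pow, reflect_lazyWalk,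
    smul_mul_smul_comm, doubleGradient, pow_add, ← Finset.mul_sum]
  congr 1
  · norm_num
  · rw [mul_mul_mul_comm, Finset.sum_mul_sum]
    simp only [Finset.mul_sum]

theorem exists_greenGradient_covariance_bound : ∃ K : ℝ, 0 ≤ K ∧ ∀ a ∈ units, ∀ b ∈ units,
    ∀ (n : ℕ) (z : Site 3), z ≠ 0 →
      |(greenGradient a (Finset.range n) * reflect (greenGradient b (Finset.range n))).coeff z| *
        √(∑ k, (z k : ℝ) ^ 2) ≤ K := by
  obtain ⟨C, hC0, hC⟩ := exists_doubleGradient_bound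
  refine ⟨6 * C, by positivity, fun a ha b hb n z hz => ?_⟩
  have hR : 1 ≤ √(∑ k, (z k : ℝ) ^ 2) := by
    rw [Real.one_le_sqrt]
    obtain ⟨k, hk⟩ := Function.ne_iff.1 hz
    refine le_trans ?_ (Finset.single_le_sum (fun k _ => sq_nonneg (z k : ℝ)) (Finset.mem_univ k))
    have h1 : 1 ≤ (z k) ^ 2 := Int.add_one_le_of_lt (sq_pos_of_ne_zero hk)
    exact_mod_cast h1
  have hsq : √(∑ k, (z k : ℝ) ^ 2) ^ 2 = ∑ k, (z k : ℝ) ^ 2 :=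
    Real.sq_sqrt (Finset.sum_nonneg fun k _ => sq_nonneg _)
  refine le_trans (mul_le_mul_of_nonneg_right ?_ (by positivity)) (sum_sum_add_mul_le
    (F := fun m => |(doubleGradient a (-b) * lazyWalk ^ m).coeff z|) (fun m => abs_nonneg _) hR
    (fun m => (hC a ha (-b) (neg_mem_units.2 hb) m z).1)
    (fun m => by rw [hsq]; exact (hC a ha (-b) (neg_mem_units.2 hb) m z).2) n)
  rw [greenGradient_mul_reflect, coeff_smul, Finsupp.smul_apply, smul_eq_mul, abs_mul, coeff_sum,
    Finsupp.finsetSum_apply]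
  refine (mul_le_of_le_one_left (abs_nonneg _) (by norm_num [abs_le])).trans
    ((Finset.abs_sum_le_sum_abs _ _).trans (Finset.sum_le_sum fun k _ => ?_))
  rw [coeff_sum, Finsupp.finsetSum_apply]
  exact Finset.abs_sum_le_sum_abs _ _

/-- The terms are `(k + 1)^(-5/4)`, the square root of the decay of a second difference of the walk.
-/
theorem summable_inv_sqrt_sqrt : Summable fun k : ℕ => 1 / √√((k : ℝ) + 1) ^ 5 := by
  have h := (summable_nat_add_iff 1).2 (Real.summable_one_div_nat_rpow.2 (by norm_num :
    (1 : ℝ) < 5 / 4))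
  refine h.congr fun k => ?_
  have hk : (0 : ℝ) ≤ (k : ℝ) + 1 := by positivity
  rw [Real.sqrt_eq_rpow, Real.sqrt_eq_rpow, ← Real.rpow_mul hk, ← Real.rpow_natCast,
    ← Real.rpow_mul hk]
  push_cast
  norm_num

/-- The bound `(k + l + 1)^(-5/2) ≤ (k + 1)^(-5/4) * (l + 1)^(-5/4)` decouples the two times. Having
it for an arbitrary set `s` of times gives the Cauchy property when `s` is an interval. -/
theorem exists_greenGradient_variance_bound : ∃ K : ℝ, 0 ≤ K ∧ ∀ a ∈ units, ∀ s : Finset ℕ,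
    |(greenGradient a s * reflect (greenGradient a s)).coeff 0| ≤
      K * (∑ k ∈ s, 1 / √√((k : ℝ) + 1) ^ 5) ^ 2 := by
  obtain ⟨C, hC0, hC⟩ := exists_doubleGradient_bound
  refine ⟨C, hC0.le, fun a ha s => ?_⟩
  rw [greenGradient_mul_reflect, coeff_smul, Finsupp.smul_apply, smul_eq_mul, abs_mul, coeff_sum,
    Finsupp.finsetSum_apply]
  refine (mul_le_of_le_one_left (abs_nonneg _) (by norm_num [abs_le])).trans ?_
  rw [sq, Finset.sum_mul_sum, Finset.mul_sum]
  refine (Finset.abs_sum_le_sum_abs _ _).trans (Finset.sum_le_sum fun k _ => ?_)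
  rw [coeff_sum, Finsupp.finsetSum_apply, Finset.mul_sum]
  refine (Finset.abs_sum_le_sum_abs _ _).trans (Finset.sum_le_sum fun l _ => ?_)
  refine (hC a ha (-a) (neg_mem_units.2 ha) (k + l) 0).1.trans ?_
  have h : ∀ m : ℕ, 0 < √√((m : ℝ) + 1) := fun m =>
    Real.sqrt_pos.2 (Real.sqrt_pos.2 (by positivity))
  have hle : ∀ m j : ℕ, m ≤ j → √√((m : ℝ) + 1) ≤ √√((j : ℝ) + 1) := fun m j hmj =>
    Real.sqrt_le_sqrt (Real.sqrt_le_sqrt (by gcongr))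
  have e : √(((k + l : ℕ) : ℝ) + 1) = √√(((k + l : ℕ) : ℝ) + 1) * √√(((k + l : ℕ) : ℝ) + 1) :=
    (Real.mul_self_sqrt (Real.sqrt_nonneg _)).symm
  rw [e, mul_pow, one_div_mul_one_div, mul_one_div]
  have hk := h k
  have hl := h l
  have h1 := hle k (k + l) (by omega)
  have h2 := hle l (k + l) (by omega)
  gcongr

end Green

/-! ### Linear functionals of the i.i.d. disorder and their covariances. -/

section Disorder

open AddMonoidAlgebra

variable (ν : Measure ℝ) [IsProbabilityMeasure ν]

instance isProbabilityMeasure_disorderLaw (d : ℕ) : IsProbabilityMeasure (disorderLaw d ν) := by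
  unfold disorderLaw; infer_instance

theorem measurable_shift {d : ℕ} (r : Site d) : Measurable (shift r) :=
  measurable_pi_lambda _ fun i => measurable_pi_apply (i - r)

theorem measurePreserving_shift {d : ℕ} (r : Site d) :
    MeasurePreserving (shift r) (disorderLaw d ν) (disorderLaw d ν) := by
  refine ⟨measurable_shift r, ?_⟩
  have h := Measure.infinitePi_map_piCongrLeft (fun _ : Site d => ν) (Equiv.addRight r)
  have e : ⇑(MeasurableEquiv.piCongrLeft (fun _ : Site d => ℝ) (Equiv.addRight r)) =
      shift r := by
    funext η i
    have := MeasurableEquiv.piCongrLeft_apply_apply (β := fun _ : Site d => ℝ)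
      (Equiv.addRight r) η (i - r)
    simpa [shift] using this
  rw [e] at h
  exact h

theorem iIndepFun_coord (d : ℕ) :
    iIndepFun (fun (i : Site d) (η : Site d → ℝ) => η i) (disorderLaw d ν) :=
  iIndepFun_infinitePi (P := fun _ : Site d => ν) (X := fun _ x => x) fun _ => measurable_id

theorem measurePreserving_coord {d : ℕ} (i : Site d) :
    MeasurePreserving (fun η : Site d → ℝ => η i) (disorderLaw d ν) ν :=
  measurePreserving_eval_infinitePi (fun _ : Site d => ν) i

variable {ν} in
theorem memLp_coord (hν : MemLp (fun x : ℝ => x) 2 ν) {d : ℕ} (i : Site d) :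
    MemLp (fun η : Site d → ℝ => η i) 2 (disorderLaw d ν) :=
  hν.comp_measurePreserving (measurePreserving_coord ν i)

/-- The action of the group algebra on fields: `f` acts on `u` by `x ↦ ∑ y, f y * u (x + y)`. -/
def act : AddMonoidAlgebra ℝ (Site 3) →ₐ[ℝ] Module.End ℝ (Site 3 → ℝ) :=
  AddMonoidAlgebra.lift ℝ (Module.End ℝ (Site 3 → ℝ)) (Site 3)
    { toFun := fun y => LinearMap.funLeft ℝ ℝ fun x => x + y.toAdd
      map_one' := by ext; simp [LinearMap.funLeft]
      map_mul' := fun y z => by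
        ext
        simp [LinearMap.funLeft, add_assoc] }

theorem act_single (y : Site 3) (r : ℝ) (u : Site 3 → ℝ) (x : Site 3) :
    act (single y r) u x = r * u (x + y) := by
  simp [act, LinearMap.funLeft]

theorem act_eq_pairing (f : AddMonoidAlgebra ℝ (Site 3)) (u : Site 3 → ℝ) (x : Site 3) :
    act f u x = pairing (fun y => u (x + y)) f := by
  induction f using AddMonoidAlgebra.induction_linear with
  | zero => simp
  | add f g hf hg => simp [hf, hg]
  | single m r => simp [act_single]

variable {ν}

theorem memLp_act (hν : MemLp (fun x : ℝ => x) 2 ν) (f : AddMonoidAlgebra ℝ (Site 3))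
    (x : Site 3) : MemLp (fun η => act f η x) 2 (disorderLaw 3 ν) := by
  simp only [act_eq_pairing, pairing_eq_sum]
  exact memLp_finsetSum _ fun y _ => (memLp_coord hν _).const_mul _

theorem integral_act (hν : MemLp (fun x : ℝ => x) 2 ν) (f : AddMonoidAlgebra ℝ (Site 3))
    (x : Site 3) : ∫ η, act f η x ∂(disorderLaw 3 ν) = pairing (fun _ => 1) f * ∫ t, t ∂ν := by
  simp only [act_eq_pairing, pairing_eq_sum]
  rw [integral_finsetSum _ fun y _ => ((memLp_coord hν _).integrable one_le_two).const_mul _,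
    Finset.sum_mul]
  refine Finset.sum_congr rfl fun y _ => ?_
  rw [integral_const_mul, mul_one]
  congr 1
  have h := integral_map (μ := disorderLaw 3 ν) (measurePreserving_coord ν (x + y)).measurable.aemeasurable
    (f := fun t : ℝ => t) (by fun_prop)
  rw [(measurePreserving_coord ν (x + y)).map_eq] at h
  exact h.symm

theorem covariance_coord (hν : MemLp (fun x : ℝ => x) 2 ν) (x y : Site 3) :
    cov[fun η => η x, fun η => η y; disorderLaw 3 ν] =
      if x = y then Var[fun t : ℝ => t; ν] else 0 := by
  split_ifs with h
  · subst h
    have h := variance_map (μ := disorderLaw 3 ν) (X := fun t : ℝ => t) (by fun_prop)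
      (measurePreserving_coord ν x).measurable.aemeasurable
    rw [(measurePreserving_coord ν x).map_eq] at h
    rw [covariance_self (memLp_coord hν x).aemeasurable]
    exact h.symm
  · exact ((iIndepFun_coord ν 3).indepFun h).covariance_eq_zero (memLp_coord hν x)
      (memLp_coord hν y)

/-- By bilinearity it suffices to take point masses, where independence leaves only coinciding
sites; these pairs are counted by the convolution with the reflected weight. -/
theorem covariance_act (hν : MemLp (fun x : ℝ => x) 2 ν) (f g : AddMonoidAlgebra ℝ (Site 3))
    (x y : Site 3) :
    cov[fun η => act f η x, fun η => act g η y; disorderLaw 3 ν] =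
      Var[fun t : ℝ => t; ν] * (f * reflect g).coeff (y - x) := by
  induction f using AddMonoidAlgebra.induction_linear with
  | zero => simp
  | add f f' hf hf' =>
    have e : (fun η => act (f + f') η x) = (fun η => act f η x) + fun η => act f' η x := by
      funext η; simp
    rw [e, covariance_add_left (memLp_act hν f x) (memLp_act hν f' x)
      (memLp_act hν g y), hf, hf', add_mul, coeff_add, Finsupp.add_apply, mul_add]
  | single m r =>
    induction g using AddMonoidAlgebra.induction_linear with
    | zero => simp
    | add g g' hg hg' =>
      have e : (fun η => act (g + g') η y) = (fun η => act g η y) + fun η => act g' η y := by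
        funext η; simp
      rw [e, covariance_add_right (memLp_act hν _ x) (memLp_act hν g y)
        (memLp_act hν g' y), hg, hg', map_add, mul_add, coeff_add, Finsupp.add_apply,
        mul_add]
    | single m' r' =>
      simp only [act_single, covariance_const_mul_left, covariance_const_mul_right,
        covariance_coord hν, reflect_single, single_mul_single, coeff_single,
        Finsupp.single_apply]
      have h : x + m = y + m' ↔ m + -m' = y - x := by
        constructor <;> intro h
        · rw [← sub_eq_add_neg, sub_eq_sub_iff_add_eq_add, add_comm m, h]
        · rw [← sub_eq_add_neg, sub_eq_sub_iff_add_eq_add] at h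
          rw [add_comm x, h]
      simp only [h]
      split_ifs <;> ring

theorem eLpNorm_two_eq_sqrt {Ω : Type*} [MeasurableSpace Ω] {P : Measure Ω} {f : Ω → ℝ}
    (hf : MemLp f 2 P) : eLpNorm f 2 P = ENNReal.ofReal (√(∫ ω, f ω ^ 2 ∂P)) := by
  rw [hf.eLpNorm_eq_integral_rpow_norm two_ne_zero ENNReal.ofNat_ne_top, Real.sqrt_eq_rpow]
  simp

end Disorder

/-! ### A mean ergodic theorem for averages along the lazy walk. -/

section Mixing

open AddMonoidAlgebra

variable {ν : Measure ℝ} [IsProbabilityMeasure ν]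

/-- The average, with weights `f`, of a random variable along the orbit of the lattice shifts. -/
def orbitAverage (f : AddMonoidAlgebra ℝ (Site 3)) (v : (Site 3 → ℝ) → ℝ) (η : Site 3 → ℝ) : ℝ :=
  pairing (fun y => v (shift (-y) η)) f

theorem orbitAverage_eq_sum (f : AddMonoidAlgebra ℝ (Site 3)) (v : (Site 3 → ℝ) → ℝ) :
    orbitAverage f v = ∑ y ∈ f.coeff.support, f.coeff y • (v ∘ shift (-y)) := by
  funext η
  simp [orbitAverage, pairing_eq_sum]

theorem orbitAverage_add (f : AddMonoidAlgebra ℝ (Site 3)) (v w : (Site 3 → ℝ) → ℝ) :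
    orbitAverage f (v + w) = orbitAverage f v + orbitAverage f w := by
  funext η
  simp [orbitAverage_eq_sum, mul_add, Finset.sum_add_distrib]

theorem orbitAverage_const_mul (f : AddMonoidAlgebra ℝ (Site 3)) (c : ℝ)
    (v : (Site 3 → ℝ) → ℝ) :
    orbitAverage f (fun η => c * v η) = fun η => c * orbitAverage f v η := by
  funext η
  simp [orbitAverage_eq_sum, Finset.mul_sum, mul_left_comm]

theorem orbitAverage_const (n : ℕ) (c : ℝ) :
    orbitAverage (lazyWalk ^ n) (fun _ => c) = fun _ => c := by
  funext η
  have h : pairing (fun _ : Site 3 => (1 : ℝ)) (lazyWalk ^ n) = 1 := by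
    rw [pairing_one_pow, pairing_one_lazyWalk, one_pow]
  simp only [orbitAverage_eq_sum, pairing_eq_sum, mul_one] at h ⊢
  simp [← Finset.sum_mul, h]

theorem aestronglyMeasurable_orbitAverage (f : AddMonoidAlgebra ℝ (Site 3))
    {v : (Site 3 → ℝ) → ℝ} (hv : AEStronglyMeasurable v (disorderLaw 3 ν)) :
    AEStronglyMeasurable (orbitAverage f v) (disorderLaw 3 ν) := by
  rw [orbitAverage_eq_sum]
  exact Finset.aestronglyMeasurable_sum _ fun y _ =>
    (hv.comp_measurePreserving (measurePreserving_shift ν (-y))).const_smul _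

theorem eLpNorm_orbitAverage_le (f : AddMonoidAlgebra ℝ (Site 3)) {v : (Site 3 → ℝ) → ℝ}
    (hv : AEStronglyMeasurable v (disorderLaw 3 ν)) :
    eLpNorm (orbitAverage f v) 1 (disorderLaw 3 ν) ≤
      ENNReal.ofReal (l1 f) * eLpNorm v 1 (disorderLaw 3 ν) := by
  rw [orbitAverage_eq_sum, l1, ENNReal.ofReal_sum_of_nonneg fun _ _ => abs_nonneg _,
    Finset.sum_mul]
  refine (eLpNorm_sum_le (fun y _ => ?_) le_rfl).trans (Finset.sum_le_sum fun y _ => ?_)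
  · exact (hv.comp_measurePreserving (measurePreserving_shift ν (-y))).const_smul _
  · rw [eLpNorm_const_smul, eLpNorm_comp_measurePreserving hv (measurePreserving_shift ν (-y)),
      Real.enorm_eq_ofReal_abs]

variable (ν) in
/-- The averages of `v` along the lazy walk converge in `L¹` to its mean. -/
def IsMixing (v : (Site 3 → ℝ) → ℝ) : Prop :=
  Tendsto (fun n : ℕ => eLpNorm (orbitAverage (lazyWalk ^ n) v -
    fun _ => ∫ η, v η ∂(disorderLaw 3 ν)) 1 (disorderLaw 3 ν)) atTop (nhds 0)

/-- Averaging with the walk is an `L¹` contraction, because its weights have `ℓ¹` norm one and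
shifts preserve the law; the class is thus closed under `L¹` limits. -/
theorem isMixing_of_approx {v : (Site 3 → ℝ) → ℝ} (hv : Integrable v (disorderLaw 3 ν))
    (h : ∀ ε : ℝ≥0∞, 0 < ε → ∃ w, Integrable w (disorderLaw 3 ν) ∧ IsMixing ν w ∧
      eLpNorm (v - w) 1 (disorderLaw 3 ν) ≤ ε) : IsMixing ν v := by
  refine ENNReal.tendsto_nhds_zero.2 fun ε hε => ?_
  have hε3 : 0 < ε / 3 := ENNReal.div_pos hε.ne' (by norm_num)
  obtain ⟨w, hw, hmix, hvw⟩ := h _ hε3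
  filter_upwards [ENNReal.tendsto_nhds_zero.1 hmix _ hε3] with n hn
  set P := disorderLaw 3 ν
  have hd : Integrable (v - w) P := hv.sub hw
  have e : orbitAverage (lazyWalk ^ n) v - (fun _ => ∫ η, v η ∂P) =
      orbitAverage (lazyWalk ^ n) (v - w) +
        (orbitAverage (lazyWalk ^ n) w - fun _ => ∫ η, w η ∂P) +
        fun _ => -∫ η, (v - w) η ∂P := by
    have h1 : orbitAverage (lazyWalk ^ n) v =
        orbitAverage (lazyWalk ^ n) (v - w) + orbitAverage (lazyWalk ^ n) w := by
      rw [← orbitAverage_add, sub_add_cancel]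
    rw [h1]
    funext η
    simp only [Pi.add_apply, Pi.sub_apply]
    rw [integral_sub hv hw]
    ring
  rw [e]
  have m1 := aestronglyMeasurable_orbitAverage (lazyWalk ^ n) hd.1
  have m2 := (aestronglyMeasurable_orbitAverage (lazyWalk ^ n) hw.1).sub
    (aestronglyMeasurable_const (b := ∫ η, w η ∂P))
  refine (eLpNorm_add_le (m1.add m2) aestronglyMeasurable_const le_rfl).trans ?_
  refine (add_le_add_left (eLpNorm_add_le m1 m2 le_rfl) _).trans ?_
  have b1 : eLpNorm (orbitAverage (lazyWalk ^ n) (v - w)) 1 P ≤ ε / 3 := by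
    refine (eLpNorm_orbitAverage_le _ hd.1).trans ?_
    rw [l1_lazyWalk_pow, ENNReal.ofReal_one, one_mul]
    exact hvw
  have b3 : eLpNorm (fun _ : Site 3 → ℝ => -∫ η, (v - w) η ∂P) 1 P ≤ ε / 3 := by
    refine le_trans ?_ hvw
    rw [eLpNorm_const _ one_ne_zero (IsProbabilityMeasure.ne_zero P), measure_univ,
      ENNReal.one_rpow, mul_one, enorm_neg, eLpNorm_one_eq_lintegral_enorm]
    exact enorm_integral_le_lintegral_enorm _
  calc _ ≤ ε / 3 + ε / 3 + ε / 3 := add_le_add (add_le_add b1 hn) b3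
    _ = ε := ENNReal.add_thirds ε

theorem IsMixing.add {v w : (Site 3 → ℝ) → ℝ} (hv : Integrable v (disorderLaw 3 ν))
    (hw : Integrable w (disorderLaw 3 ν)) (h : IsMixing ν v) (h' : IsMixing ν w) :
    IsMixing ν (v + w) := by
  have hlim := Tendsto.add h h'
  rw [add_zero] at hlim
  refine tendsto_of_tendsto_of_tendsto_of_le_of_le tendsto_const_nhds hlim
    (fun _ => zero_le) fun n => ?_
  have e : orbitAverage (lazyWalk ^ n) (v + w) - (fun _ => ∫ η, (v + w) η ∂(disorderLaw 3 ν)) =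
      (orbitAverage (lazyWalk ^ n) v - fun _ => ∫ η, v η ∂(disorderLaw 3 ν)) +
        (orbitAverage (lazyWalk ^ n) w - fun _ => ∫ η, w η ∂(disorderLaw 3 ν)) := by
    rw [orbitAverage_add]
    funext η
    simp only [Pi.add_apply, Pi.sub_apply]
    rw [integral_add hv hw]
    ring
  dsimp only
  rw [e]
  exact eLpNorm_add_le ((aestronglyMeasurable_orbitAverage _ hv.1).sub aestronglyMeasurable_const)
    ((aestronglyMeasurable_orbitAverage _ hw.1).sub aestronglyMeasurable_const) le_rfl

theorem IsMixing.const_mul {v : (Site 3 → ℝ) → ℝ} (h : IsMixing ν v) (c : ℝ) :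
    IsMixing ν (fun η => c * v η) := by
  have hlim := ENNReal.Tendsto.const_mul (a := ‖c‖ₑ) h (Or.inr enorm_ne_top)
  rw [mul_zero] at hlim
  refine hlim.congr fun n => ?_
  rw [← eLpNorm_const_smul]
  congr 1
  rw [orbitAverage_const_mul, integral_const_mul]
  funext η
  simp [mul_sub]

theorem isMixing_const (c : ℝ) : IsMixing ν (fun _ => c) := by
  simp only [IsMixing, orbitAverage_const, integral_const, probReal_univ, one_smul, sub_self,
    eLpNorm_zero]
  exact tendsto_const_nhds

theorem abs_covariance_le_one {Ω : Type*} [MeasurableSpace Ω] {P : Measure Ω}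
    [IsProbabilityMeasure P] {X Y : Ω → ℝ} (hX : Measurable X) (hY : Measurable Y)
    (hX1 : ∀ ω, X ω ∈ Set.Icc (0 : ℝ) 1) (hY1 : ∀ ω, Y ω ∈ Set.Icc (0 : ℝ) 1) :
    |cov[X, Y; P]| ≤ 1 := by
  have key : ∀ {Z : Ω → ℝ}, Measurable Z → (∀ ω, Z ω ∈ Set.Icc (0 : ℝ) 1) →
      ∀ ω, |Z ω - ∫ ω', Z ω' ∂P| ≤ 1 := fun {Z} hZ hZ1 ω => by
    have hi : Integrable Z P := Integrable.of_bound hZ.aestronglyMeasurable 1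
      (Eventually.of_forall fun ω => by
        rw [Real.norm_eq_abs, abs_of_nonneg (hZ1 ω).1]; exact (hZ1 ω).2)
    have h0 : 0 ≤ ∫ ω', Z ω' ∂P := integral_nonneg fun ω => (hZ1 ω).1
    have h1 : ∫ ω', Z ω' ∂P ≤ 1 := by
      simpa using integral_mono hi (integrable_const (1 : ℝ)) fun ω => (hZ1 ω).2
    rw [abs_le]
    constructor <;> linarith [(hZ1 ω).1, (hZ1 ω).2]
  have h := norm_integral_le_of_norm_le_const (μ := P) (C := 1)
    (f := fun ω => (X ω - ∫ ω', X ω' ∂P) * (Y ω - ∫ ω', Y ω' ∂P))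
    (Eventually.of_forall fun ω => by
      rw [norm_mul]
      exact mul_le_one₀ (key hX hX1 ω) (norm_nonneg _) (key hY hY1 ω))
  simpa [covariance] using h

/-- A bounded random variable depending on finitely many sites is mixing. -/
theorem isMixing_of_local {Λ : Finset (Site 3)} {g : (Λ → ℝ) → ℝ} (hg : Measurable g)
    (hg1 : ∀ x, g x ∈ Set.Icc (0 : ℝ) 1) : IsMixing ν (fun η => g (Λ.restrict η)) := by
  classical
  set P := disorderLaw 3 ν
  set w : (Site 3 → ℝ) → ℝ := fun η => g (Λ.restrict η)
  have hw : Measurable w := hg.comp (Finset.measurable_restrict Λ)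
  have hwy : ∀ y, Measurable (w ∘ shift y) := fun y => hw.comp (measurable_shift y)
  have hL : ∀ y, MemLp (w ∘ shift y) 2 P := fun y =>
    MemLp.of_bound (hwy y).aestronglyMeasurable 1 (Eventually.of_forall fun η => by
      have := hg1 (Λ.restrict (shift y η))
      change ‖g (Λ.restrict (shift y η))‖ ≤ 1
      rw [Real.norm_eq_abs, abs_of_nonneg this.1]
      exact this.2)
  -- The shifted variables depend on the sites of `Λ + y` and `Λ + z`; these sets meet only if `z -
  -- y` lies in the difference set `D`, and otherwise the variables are independent.
  let D : Finset (Site 3) := Finset.image₂ (fun i j => i - j) Λ Λ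
  have hcov : ∀ y z, |cov[w ∘ shift (-y), w ∘ shift (-z); P]| ≤
      if z - y ∈ D then 1 else 0 := fun y z => by
    split_ifs with h
    · exact abs_covariance_le_one (hwy _) (hwy _) (fun η => hg1 _) (fun η => hg1 _)
    · have hdisj : Disjoint (Λ.image (· + y)) (Λ.image (· + z)) := by
        rw [Finset.disjoint_left]
        rintro x hx hx'
        obtain ⟨i, hi, rfl⟩ := Finset.mem_image.1 hx
        obtain ⟨j, hj, hij⟩ := Finset.mem_image.1 hx'
        refine h (Finset.mem_image₂.2 ⟨i, hi, j, hj, ?_⟩)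
        rw [sub_eq_sub_iff_add_eq_add, ← hij, add_comm]
      have hind := (iIndepFun_coord ν 3).indepFun_finset _ _ hdisj fun i => measurable_pi_apply i
      have hrep : ∀ y, w ∘ shift (-y) =
          (fun x : (Λ.image (· + y) : Finset (Site 3)) → ℝ => g fun i : Λ =>
            x ⟨i + y, Finset.mem_image_of_mem _ i.2⟩) ∘ fun (η : Site 3 → ℝ)
              (i : (Λ.image (· + y) : Finset (Site 3))) => η i := fun y => by
        funext η
        simp only [w, Function.comp_apply]
        congr 1
        funext i
        simp [shift]
      have hm : ∀ y, Measurable (fun x : (Λ.image (· + y) : Finset (Site 3)) → ℝ => g fun i : Λ =>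
            x ⟨i + y, Finset.mem_image_of_mem _ i.2⟩) := fun y =>
        hg.comp (measurable_pi_lambda _ fun i => measurable_pi_apply _)
      have hind' : IndepFun (w ∘ shift (-y)) (w ∘ shift (-z)) P := by
        rw [hrep y, hrep z]
        exact hind.comp (hm y) (hm z)
      rw [hind'.covariance_eq_zero (hL _) (hL _), abs_zero]
  obtain ⟨C, hC⟩ := exists_coeff_lazyWalk_pow_le
  have hmean : ∀ n, ∫ η, orbitAverage (lazyWalk ^ n) w η ∂P = ∫ η, w η ∂P := fun n => by
    have h1 : ∀ y, ∫ η, w (shift (-y) η) ∂P = ∫ η, w η ∂P := fun y => by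
      have h := integral_map (μ := P) (measurable_shift (-y)).aemeasurable (f := w)
        hw.aestronglyMeasurable
      rw [(measurePreserving_shift ν (-y)).map_eq] at h
      exact h.symm
    have h2 := pairing_one_pow lazyWalk n
    rw [pairing_one_lazyWalk, one_pow, pairing_eq_sum] at h2
    have hi : ∀ y, Integrable (fun η => w (shift (-y) η)) P := fun y =>
      (hL (-y)).integrable one_le_two
    simp only [orbitAverage, pairing_eq_sum]
    rw [integral_finsetSum _ fun y _ => (hi y).const_mul _]
    simp only [integral_const_mul, h1]
    rw [← Finset.sum_mul]
    simpa using congrArg (· * ∫ η, w η ∂P) h2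
  have hmem : ∀ n, MemLp (orbitAverage (lazyWalk ^ n) w) 2 P := fun n => by
    rw [orbitAverage_eq_sum]
    exact memLp_finsetSum' _ fun y _ => (hL (-y)).const_smul _
  -- For each `y` at most `D.card` sites `z` are correlated with it, each of weight at most the sup
  -- of the heat kernel, which tends to zero.
  have hvar : ∀ n : ℕ, Var[orbitAverage (lazyWalk ^ n) w; P] ≤
      D.card * (C / √((n : ℝ) + 1) ^ 3) := fun n => by
    rw [← covariance_self (hmem n).aemeasurable, orbitAverage_eq_sum,
      covariance_sum_sum' (fun y _ => (hL (-y)).const_smul _) (fun y _ => (hL (-y)).const_smul _)]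
    have hnn := coeff_pow_nonneg coeff_lazyWalk_nonneg n
    set S := (lazyWalk ^ n).coeff.support
    set c := (lazyWalk ^ n).coeff
    have h1 : ∑ y ∈ S, c y = 1 := by
      have h2 := pairing_one_pow lazyWalk n
      rw [pairing_one_lazyWalk, one_pow, pairing_eq_sum] at h2
      simpa using h2
    calc ∑ y ∈ S, ∑ z ∈ S, cov[c y • (w ∘ shift (-y)), c z • (w ∘ shift (-z)); P]
        ≤ ∑ y ∈ S, c y * ∑ z ∈ S, if z - y ∈ D then c z else 0 := by
          refine Finset.sum_le_sum fun y _ => ?_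
          rw [Finset.mul_sum]
          refine Finset.sum_le_sum fun z _ => ?_
          rw [covariance_smul_left, covariance_smul_right]
          refine mul_le_mul_of_nonneg_left ?_ (hnn y)
          refine (mul_le_mul_of_nonneg_left ((le_abs_self _).trans (hcov y z)) (hnn z)).trans ?_
          simp
      _ ≤ ∑ y ∈ S, c y * (D.card * (C / √((n : ℝ) + 1) ^ 3)) := by
          refine Finset.sum_le_sum fun y _ => mul_le_mul_of_nonneg_left ?_ (hnn y)
          rw [← Finset.sum_filter]
          have hsub : S.filter (fun z => z - y ∈ D) ⊆ D.image (· + y) := fun z hz =>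
            Finset.mem_image.2 ⟨z - y, (Finset.mem_filter.1 hz).2, sub_add_cancel z y⟩
          refine (Finset.sum_le_sum_of_subset_of_nonneg hsub fun z _ _ => hnn z).trans ?_
          refine (Finset.sum_le_card_nsmul _ _ _ fun z _ =>
            (le_abs_self _).trans (hC n z)).trans ?_
          rw [nsmul_eq_mul]
          refine mul_le_mul_of_nonneg_right (by exact_mod_cast Finset.card_image_le) ?_
          exact (abs_nonneg _).trans (hC n 0)
      _ = D.card * (C / √((n : ℝ) + 1) ^ 3) := by rw [← Finset.sum_mul, h1, one_mul]
  have hlim : Tendsto (fun n : ℕ => ENNReal.ofReal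
      (√(D.card * (C / √((n : ℝ) + 1) ^ 3)))) atTop (nhds 0) := by
    rw [← ENNReal.ofReal_zero]
    refine (ENNReal.continuous_ofReal.tendsto 0).comp ?_
    rw [← Real.sqrt_zero]
    refine (Real.continuous_sqrt.tendsto 0).comp ?_
    rw [← mul_zero (D.card : ℝ)]
    refine Tendsto.const_mul _ (Tendsto.div_atTop tendsto_const_nhds ?_)
    refine (tendsto_pow_atTop three_ne_zero).comp (Real.tendsto_sqrt_atTop.comp ?_)
    exact tendsto_atTop_add_const_right _ _ tendsto_natCast_atTop_atTop
  refine tendsto_of_tendsto_of_tendsto_of_le_of_le tendsto_const_nhds hlim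
    (fun _ => zero_le) fun n => ?_
  have hm := (hmem n).sub (memLp_const (∫ η, w η ∂P))
  refine (eLpNorm_le_eLpNorm_of_exponent_le one_le_two hm.1).trans ?_
  rw [eLpNorm_two_eq_sqrt hm]
  refine ENNReal.ofReal_le_ofReal (Real.sqrt_le_sqrt ?_)
  refine le_trans (le_of_eq ?_) (hvar n)
  rw [variance_eq_integral (hmem n).aemeasurable, hmean]
  rfl

/-- Dynkin's π-λ theorem from cylinder sets: complements use linearity, and countable disjoint
unions are `L¹` limits of finite ones. -/
theorem isMixing_indicator {A : Set (Site 3 → ℝ)} (hA : MeasurableSet A) :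
    IsMixing ν (A.indicator fun _ => 1) := by
  have hint : ∀ {B : Set (Site 3 → ℝ)}, MeasurableSet B →
      Integrable (B.indicator fun _ => (1 : ℝ)) (disorderLaw 3 ν) :=
    fun hB => (integrable_const _).indicator hB
  refine MeasurableSpace.induction_on_inter
    (C := fun A _ => IsMixing ν (A.indicator fun _ => (1 : ℝ)))
    (generateFrom_measurableCylinders (α := fun _ : Site 3 => ℝ)).symm
    isPiSystem_measurableCylinders ?_ ?_ ?_ ?_ A hA
  · simpa using isMixing_const (ν := ν) 0
  · intro B hB
    obtain ⟨Λ, S, hS, rfl⟩ := (mem_measurableCylinders _).1 hB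
    have h := isMixing_of_local (ν := ν) (Λ := Λ) (g := S.indicator fun _ => (1 : ℝ))
      (measurable_const.indicator hS) fun x => by
        by_cases hx : x ∈ S <;> simp [hx]
    exact h
  · intro B hB h
    have e : (Bᶜ.indicator fun _ => (1 : ℝ)) =
        (fun _ => (1 : ℝ)) + fun η => (-1) * (B.indicator (fun _ => (1 : ℝ)) η) := by
      funext η
      by_cases hη : η ∈ B <;> simp [hη]
    rw [e]
    exact (isMixing_const 1).add (integrable_const _) ((hint hB).const_mul _) (h.const_mul _)
  · intro f hf hfm hmix
    have hacc : ∀ n, MeasurableSet (Set.accumulate f n) := fun n =>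
      MeasurableSet.biUnion (Set.to_countable _) fun i _ => hfm i
    have hmixacc : ∀ n, IsMixing ν ((Set.accumulate f n).indicator fun _ => (1 : ℝ)) := fun n => by
      induction n with
      | zero => simpa [Set.accumulate_zero_nat] using hmix 0
      | succ n ih =>
        have hdis : Disjoint (Set.accumulate f n) (f (n + 1)) := by
          rw [Set.accumulate_def, Set.disjoint_iUnion₂_left]
          intro i hi
          exact hf (by omega)
        rw [Set.accumulate_succ, Set.indicator_union_of_disjoint hdis]
        exact ih.add (hint (hacc n)) (hint (hfm _)) (hmix _)
    refine isMixing_of_approx (hint (MeasurableSet.iUnion hfm)) fun ε hε => ?_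
    have hlim : Tendsto (fun n => disorderLaw 3 ν (⋃ i, f i) -
        disorderLaw 3 ν (Set.accumulate f n)) atTop (nhds 0) := by
      have h := ENNReal.Tendsto.sub (tendsto_const_nhds (x := disorderLaw 3 ν (⋃ i, f i)))
        (tendsto_measure_iUnion_accumulate (μ := disorderLaw 3 ν) (f := f))
        (Or.inl (measure_ne_top _ _))
      rwa [tsub_self] at h
    obtain ⟨n, hn⟩ := (ENNReal.tendsto_nhds_zero.1 hlim ε hε).exists
    refine ⟨_, hint (hacc n), hmixacc n, le_trans (le_of_eq ?_) hn⟩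
    have hsub : Set.accumulate f n ⊆ ⋃ i, f i := Set.accumulate_subset_iUnion n
    rw [← measure_sdiff hsub (hacc n).nullMeasurableSet (measure_ne_top _ _),
      ← Set.indicator_sdiff hsub,
      eLpNorm_indicator_const ((MeasurableSet.iUnion hfm).diff (hacc n)) one_ne_zero
        ENNReal.one_ne_top]
    simp

/-- The mean ergodic theorem along the lazy walk, for i.i.d. disorder. -/
theorem isMixing_of_integrable {v : (Site 3 → ℝ) → ℝ} (hv : Integrable v (disorderLaw 3 ν)) :
    IsMixing ν v := by
  refine Integrable.induction (IsMixing ν) ?_ ?_ ?_ ?_ hv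
  · intro c A hA _
    have e : (A.indicator fun _ => c) = fun η => c * A.indicator (fun _ => (1 : ℝ)) η := by
      funext η
      by_cases hη : η ∈ A <;> simp [hη]
    rw [e]
    exact (isMixing_indicator hA).const_mul c
  · intro f g _ hf hg hf' hg'
    exact hf'.add hf hg hg'
  · refine isClosed_of_closure_subset fun f hf => ?_
    refine isMixing_of_approx (L1.integrable_coeFn f) fun ε hε => ?_
    obtain ⟨g, hg, hfg⟩ := EMetric.mem_closure_iff.1 hf ε hε
    refine ⟨g, L1.integrable_coeFn g, hg, ?_⟩
    rw [Lp.edist_def] at hfg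
    exact hfg.le
  · intro f g hfg hf h
    refine isMixing_of_approx (hf.congr hfg) fun ε _ => ⟨f, hf, h, ?_⟩
    have h0 : g - f =ᵐ[disorderLaw 3 ν] 0 := by
      filter_upwards [hfg] with η hη
      simp [hη]
    rw [eLpNorm_congr_ae h0]
    simp

end Mixing

/-! ### From the one-site DLR equation to the equation for the mean gradient field. -/

section DLR

open AddMonoidAlgebra

theorem nnKernel_eq (y : Site 3) : nnKernel 3 y = if y ∈ units then 1 / 6 else 0 := by
  simp only [nnKernel, mem_units]
  norm_num

theorem nnKernel_pos_iff {y : Site 3} : 0 < nnKernel 3 y ↔ y ∈ units := by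
  rw [nnKernel_eq]
  split_ifs with h <;> simp [h]

/-- The edge from `i` to its neighbour `i + y`. -/
def edgeTo (i : Site 3) (y : units) : Edge (nnKernel 3) :=
  ⟨(i, i + y), by
    rw [nnKernel_pos_iff, sub_add_cancel_left]
    exact neg_mem_units.2 y.2⟩

theorem grad_potential (u : GradConf (nnKernel 3)) (e : Edge (nnKernel 3)) :
    potential u e.1.1 - potential u e.1.2 = u.1 e :=
  congrFun (Classical.choose_spec (exists_potential u)).2 e

theorem deriv_gaussianPotential (t : ℝ) : deriv gaussianPotential t = t := by
  have h : HasDerivAt gaussianPotential (((2 : ℕ) : ℝ) * t ^ (2 - 1) / 2) t :=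
    (hasDerivAt_pow 2 t).div_const 2
  rw [h.deriv]
  simp

/-- The divergence of a gradient configuration at the site `i`. -/
def divergence (i : Site 3) (u : GradConf (nnKernel 3)) : ℝ :=
  ∑ y : units, 1 / 6 * u.1 (edgeTo i y)

theorem measurable_divergence (i : Site 3) : Measurable (divergence i) :=
  Finset.measurable_sum _ fun y _ =>
    ((measurable_pi_apply (edgeTo i y)).comp measurable_subtype_coe).const_mul _

theorem measurable_toGradConf : Measurable (toGradConf (nnKernel 3)) :=
  Measurable.subtype_mk (measurable_pi_lambda _ fun e =>
    (measurable_pi_apply e.1.1).sub (measurable_pi_apply e.1.2))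

theorem measurable_glue (Λ : Finset (Site 3)) (b : Site 3 → ℝ) : Measurable (glue Λ b) := by
  refine measurable_pi_lambda _ fun i => ?_
  by_cases h : i ∈ Λ
  · simpa [glue, h] using measurable_pi_apply (⟨i, h⟩ : Λ)
  · simp [glue, h]

theorem glue_singleton_self (i : Site 3) (b : Site 3 → ℝ) (x : ({i} : Finset (Site 3)) → ℝ) :
    glue {i} b x i = x default := by
  simp only [glue, Finset.mem_singleton, dif_pos]
  congr

theorem glue_singleton_add (i : Site 3) (b : Site 3 → ℝ) (x : ({i} : Finset (Site 3)) → ℝ)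
    {y : Site 3} (hy : y ∈ units) : glue {i} b x (i + y) = b (i + y) := by
  have : y ≠ 0 := fun h => zero_notMem_units (h ▸ hy)
  simp [glue, this]

theorem divergence_toGradConf (i : Site 3) (φ : Site 3 → ℝ) :
    divergence i (toGradConf _ φ) = φ i - ∑ y ∈ units, 1 / 6 * φ (i + y) := by
  have h : divergence i (toGradConf _ φ) = ∑ y ∈ units, 1 / 6 * (φ i - φ (i + y)) :=
    Finset.sum_coe_sort units fun y => 1 / 6 * (φ i - φ (i + y))
  rw [h]
  simp only [mul_sub, Finset.sum_sub_distrib, Finset.sum_const, card_units, nsmul_eq_mul]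
  push_cast
  ring

theorem energy_singleton (i : Site 3) (η b : Site 3 → ℝ) (x : ({i} : Finset (Site 3)) → ℝ) :
    energy (nnKernel 3) gaussianPotential {i} η (glue {i} b x) =
      ∑ y ∈ units, 1 / 6 * ((x default - b (i + y)) ^ 2 / 2) - η i * x default := by
  have h0 : nnKernel 3 0 = 0 := by rw [nnKernel_eq, if_neg zero_notMem_units]
  have hts : ∑' j : {j : Site 3 // j ∉ ({i} : Finset (Site 3))},
      nnKernel 3 (i - j) * gaussianPotential (glue {i} b x i - glue {i} b x j) =
        ∑ y ∈ units, 1 / 6 * ((x default - b (i + y)) ^ 2 / 2) := by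
    have h1 := tsum_subtype {j : Site 3 | j ∉ ({i} : Finset (Site 3))}
      fun j => nnKernel 3 (i - j) * gaussianPotential (glue {i} b x i - glue {i} b x j)
    refine h1.trans ?_
    rw [← (Equiv.addLeft i).tsum_eq, tsum_eq_sum (s := units)]
    · refine Finset.sum_congr rfl fun y hy => ?_
      have hy0 : y ≠ 0 := fun h => zero_notMem_units (h ▸ hy)
      rw [Set.indicator_of_mem (by simp [hy0]), Equiv.coe_addLeft, glue_singleton_self,
        glue_singleton_add i b x hy, sub_add_cancel_left, nnKernel_eq,
        if_pos (neg_mem_units.2 hy)]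
      rfl
    · intro y hy
      refine Set.indicator_apply_eq_zero.2 fun _ => ?_
      rw [Equiv.coe_addLeft, sub_add_cancel_left, nnKernel_eq,
        if_neg (fun h => hy (neg_mem_units.1 h)), zero_mul]
  simp only [energy, Finset.sum_singleton, sub_self, h0, zero_mul, mul_zero, zero_add]
  rw [hts, glue_singleton_self]

/-- Completing the square: the height at `i` is Gaussian around `η i` plus the average of its
neighbours. The factor `K` collects what does not depend on that height and cancels on
normalization. -/
theorem exists_weight_singleton (i : Site 3) (η b : Site 3 → ℝ) :
    ∃ K : ℝ≥0∞, K ≠ 0 ∧ K ≠ ⊤ ∧ ∀ x : ({i} : Finset (Site 3)) → ℝ,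
      weight (nnKernel 3) gaussianPotential {i} η b x =
        K * gaussianPDF (η i + ∑ y ∈ units, 1 / 6 * b (i + y)) 1 (x default) := by
  set m := ∑ y ∈ units, 1 / 6 * b (i + y) with hm
  set c := ∑ y ∈ units, 1 / 6 * (b (i + y) ^ 2 / 2) with hc
  refine ⟨ENNReal.ofReal (√(2 * Real.pi) * Real.exp ((η i + m) ^ 2 / 2 - c)),
    (ENNReal.ofReal_pos.2 (by positivity)).ne', ENNReal.ofReal_ne_top, fun x => ?_⟩
  have hE : energy (nnKernel 3) gaussianPotential {i} η (glue {i} b x) =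
      (x default - (η i + m)) ^ 2 / 2 - ((η i + m) ^ 2 / 2 - c) := by
    have h : ∀ t : ℝ, ∑ y ∈ units, 1 / 6 * ((t - b (i + y)) ^ 2 / 2) = t ^ 2 / 2 - t * m + c := by
      intro t
      have h1 : ∀ y ∈ units, 1 / 6 * ((t - b (i + y)) ^ 2 / 2) =
          1 / 6 * (t ^ 2 / 2) - t * (1 / 6 * b (i + y)) + 1 / 6 * (b (i + y) ^ 2 / 2) :=
        fun y _ => by ring
      rw [Finset.sum_congr rfl h1, Finset.sum_add_distrib, Finset.sum_sub_distrib,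
        ← Finset.mul_sum units _ t, ← hm, ← hc, Finset.sum_const, card_units, nsmul_eq_mul]
      push_cast
      ring
    rw [energy_singleton, h]
    ring
  rw [weight, hE, gaussianPDF, gaussianPDFReal, ← ENNReal.ofReal_mul (by positivity)]
  congr 1
  rw [show -((x default - (η i + m)) ^ 2 / 2 - ((η i + m) ^ 2 / 2 - c)) =
    ((η i + m) ^ 2 / 2 - c) + -(x default - (η i + m)) ^ 2 / 2 by ring, Real.exp_add]
  simp only [NNReal.coe_one, mul_one]
  field_simp

/-- The boundary condition only translates the height by the neighbour average `m`, and the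
divergence subtracts exactly `m`. The resulting law is free of `u`, so it survives integration over
any gradient Gibbs measure. -/
theorem finiteGradGibbs_singleton_preimage (i : Site 3) (η : Site 3 → ℝ)
    (u : GradConf (nnKernel 3)) {A : Set ℝ} (hA : MeasurableSet A) :
    finiteGradGibbs (nnKernel 3) gaussianPotential {i} η u (divergence i ⁻¹' A) =
      gaussianReal (η i) 1 A := by
  set b := potential u
  obtain ⟨K, hK0, hKt, hK⟩ := exists_weight_singleton i η b
  set m := ∑ y ∈ units, 1 / 6 * b (i + y) with hm
  have hF : ∀ x, divergence i (toGradConf _ (glue {i} b x)) = x default - m := fun x => by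
    rw [divergence_toGradConf, glue_singleton_self, hm]
    congr 1
    exact Finset.sum_congr rfl fun y hy => by rw [glue_singleton_add i b x hy]
  have hvol : ∀ B : Set ℝ, MeasurableSet B →
      (volume.withDensity (weight (nnKernel 3) gaussianPotential {i} η b))
        ((fun x : ({i} : Finset (Site 3)) → ℝ => x default) ⁻¹' B) =
        K * gaussianReal (η i + m) 1 B := fun B hB => by
    have hmp := volume_preserving_funUnique ({i} : Finset (Site 3)) ℝ
    have hB' : MeasurableSet ((fun x : ({i} : Finset (Site 3)) → ℝ => x default) ⁻¹' B) :=
      measurable_pi_apply _ hB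
    rw [withDensity_apply _ hB', setLIntegral_congr_fun hB' fun x _ => hK x]
    refine (hmp.setLIntegral_comp_preimage hB
      (f := fun t => K * gaussianPDF (η i + m) 1 t) (by fun_prop)).trans ?_
    rw [lintegral_const_mul _ (by fun_prop), gaussianReal_apply _ one_ne_zero]
  have hZ : ∫⁻ x, weight (nnKernel 3) gaussianPotential {i} η b x = K := by
    have h := hvol Set.univ MeasurableSet.univ
    rw [Set.preimage_univ, withDensity_apply _ MeasurableSet.univ, setLIntegral_univ,
      measure_univ, mul_one] at h
    exact h
  have hdA := measurable_divergence i hA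
  have e : glue {i} b ⁻¹' (toGradConf (nnKernel 3) ⁻¹' (divergence i ⁻¹' A)) =
      (fun x : ({i} : Finset (Site 3)) → ℝ => x default) ⁻¹' ((fun t => t - m) ⁻¹' A) := by
    ext x
    simp [hF]
  have hmA : MeasurableSet ((fun t => t - m) ⁻¹' A) := (measurable_id.sub_const m) hA
  rw [finiteGradGibbs, Measure.map_apply measurable_toGradConf hdA, finiteGibbs,
    Measure.smul_apply, Measure.map_apply (measurable_glue _ _) (measurable_toGradConf hdA), hZ, e,
    hvol _ hmA, smul_eq_mul, ← mul_assoc, ENNReal.inv_mul_cancel hK0 hKt, one_mul,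
    ← Measure.map_apply (by fun_prop) hA, gaussianReal_map_sub_const, add_sub_cancel_right]

/-- Under a gradient Gibbs measure, the divergence at `i` is Gaussian with mean `η i`. -/
theorem map_divergence {η : Site 3 → ℝ} {μ : Measure (GradConf (nnKernel 3))}
    [IsProbabilityMeasure μ] (h : IsGradientGibbs (nnKernel 3) gaussianPotential η μ)
    (i : Site 3) : μ.map (divergence i) = gaussianReal (η i) 1 := by
  ext A hA
  rw [Measure.map_apply (measurable_divergence i) hA, ← h {i} _ (measurable_divergence i hA)]
  simp [finiteGradGibbs_singleton_preimage i η _ hA]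

/-- The mean height difference between two sites. -/
def meanDiff (μ : Measure (GradConf (nnKernel 3))) (x y : Site 3) : ℝ :=
  ∫ u, (potential u x - potential u y) ∂μ

variable {η : Site 3 → ℝ} {μ : Measure (GradConf (nnKernel 3))}

theorem integrable_potential_sub (hi : ∀ e, Integrable (fun u : GradConf (nnKernel 3) => u.1 e) μ)
    (x : Site 3) {y : Site 3} (hy : y ∈ units) :
    Integrable (fun u : GradConf (nnKernel 3) => potential u x - potential u (x + y)) μ :=
  (hi (edgeTo x ⟨y, hy⟩)).congr
    (Eventually.of_forall fun u => (grad_potential u (edgeTo x ⟨y, hy⟩)).symm)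

/-- The mean gradient field solves the divergence equation with the disorder as its source. -/
theorem sum_meanDiff [IsProbabilityMeasure μ]
    (h : IsGradientGibbs (nnKernel 3) gaussianPotential η μ)
    (hi : ∀ e, Integrable (fun u : GradConf (nnKernel 3) => u.1 e) μ) (i : Site 3) :
    ∑ y ∈ units, 1 / 6 * meanDiff μ i (i + y) = η i := by
  have h1 : ∫ u, divergence i u ∂μ = η i := by
    have h2 := integral_map (measurable_divergence i).aemeasurable (μ := μ)
      (f := fun t : ℝ => t) aestronglyMeasurable_id
    rw [map_divergence h i, integral_id_gaussianReal] at h2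
    exact h2.symm
  rw [← h1]
  simp only [divergence]
  rw [integral_finsetSum _ fun y _ => (hi _).const_mul _, ← Finset.sum_coe_sort units]
  refine Finset.sum_congr rfl fun y _ => ?_
  rw [integral_const_mul]
  congr 1
  exact integral_congr_ae (Eventually.of_forall fun u => grad_potential u (edgeTo i y))

/-- The mean field is curl-free: both sides are the mean of the same alternating sum of heights
around a plaquette. Only neighbour differences are integrated, so integrability on edges suffices.
-/
theorem meanDiff_sub_meanDiff (hi : ∀ e, Integrable (fun u : GradConf (nnKernel 3) => u.1 e) μ)
    (x : Site 3) {a y : Site 3} (ha : a ∈ units) (hy : y ∈ units) :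
    meanDiff μ x (x + a) - meanDiff μ (x + y) (x + y + a) =
      meanDiff μ x (x + y) - meanDiff μ (x + a) (x + a + y) := by
  simp only [meanDiff]
  rw [← integral_sub (integrable_potential_sub hi _ ha) (integrable_potential_sub hi _ ha),
    ← integral_sub (integrable_potential_sub hi _ hy) (integrable_potential_sub hi _ hy)]
  congr 1
  funext u
  rw [add_right_comm x y a]
  ring

/-- Curl-freeness exchanges the directions `a` and `y`, turning the Laplacian of one component into
the `a`-gradient of the divergence, hence of `η`. The factor `1 / 2` is the laziness. -/
theorem act_one_sub_lazyWalk_meanDiff [IsProbabilityMeasure μ]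
    (h : IsGradientGibbs (nnKernel 3) gaussianPotential η μ)
    (hi : ∀ e, Integrable (fun u : GradConf (nnKernel 3) => u.1 e) μ) {a : Site 3}
    (ha : a ∈ units) :
    act (1 - lazyWalk) (fun x => meanDiff μ x (x + a)) =
      act ((1 / 2 : ℝ) • (1 - single a 1)) η := by
  funext x
  have e1 : act (1 - lazyWalk) (fun x => meanDiff μ x (x + a)) x =
      ∑ y ∈ units, 1 / 12 * (meanDiff μ x (x + a) - meanDiff μ (x + y) (x + y + a)) := by
    simp only [lazyWalk, map_sub, map_add, map_sum, map_one, LinearMap.sub_apply,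
      LinearMap.add_apply, LinearMap.sum_apply, Module.End.one_apply, Pi.sub_apply, Pi.add_apply,
      Finset.sum_apply, act_single, add_zero, mul_sub, Finset.sum_sub_distrib, Finset.sum_const,
      card_units, nsmul_eq_mul]
    push_cast
    ring
  have e2 : act ((1 / 2 : ℝ) • (1 - single a 1)) η x = 1 / 2 * (η x - η (x + a)) := by
    simp only [map_sub, map_smul, map_one, LinearMap.smul_apply, LinearMap.sub_apply,
      Module.End.one_apply, Pi.smul_apply, Pi.sub_apply, act_single, smul_eq_mul, one_mul]
  rw [e1, e2, ← sum_meanDiff h hi x, ← sum_meanDiff h hi (x + a), ← Finset.sum_sub_distrib,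
    Finset.mul_sum]
  refine Finset.sum_congr rfl fun y hy => ?_
  rw [meanDiff_sub_meanDiff hi x ha hy]
  ring

/-- The mean gradient field is the sum of the Green gradient of the disorder up to time `n` and of
the average of the field over the position at time `n` of the lazy walk. -/
theorem meanDiff_eq [IsProbabilityMeasure μ]
    (h : IsGradientGibbs (nnKernel 3) gaussianPotential η μ)
    (hi : ∀ e, Integrable (fun u : GradConf (nnKernel 3) => u.1 e) μ) {a : Site 3}
    (ha : a ∈ units) (n : ℕ) (x : Site 3) :
    meanDiff μ x (x + a) = act (greenGradient a (Finset.range n)) η x +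
      act (lazyWalk ^ n) (fun x => meanDiff μ x (x + a)) x := by
  have e1 : greenGradient a (Finset.range n) =
      (∑ k ∈ Finset.range n, lazyWalk ^ k) * ((1 / 2 : ℝ) • (1 - single a 1)) := by
    rw [greenGradient, mul_smul_comm, mul_comm]
  have e2 : act (greenGradient a (Finset.range n)) η =
      act (1 - lazyWalk ^ n) (fun x => meanDiff μ x (x + a)) := by
    rw [e1, map_mul, Module.End.mul_apply, ← act_one_sub_lazyWalk_meanDiff h hi ha,
      ← Module.End.mul_apply, ← map_mul, geom_sum_mul_neg]
  rw [e2]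
  simp [map_sub]

end DLR

/-! ### Upgrading `L¹` convergence to `L²`, and passing to the limit in products. -/

section SquareIntegrable

variable {Ω : Type*} [MeasurableSpace Ω] {P : Measure Ω}

/-- A sequence converging in `L¹` and Cauchy in `L²` converges in `L²` at the Cauchy rate. -/
theorem eLpNorm_sub_le_of_cauchy {G : ℕ → Ω → ℝ} {w : Ω → ℝ} {δ : ℕ → ℝ≥0∞}
    (hG : ∀ n, MemLp (G n) 2 P) (hw : AEStronglyMeasurable w P)
    (h1 : Tendsto (fun n => eLpNorm (G n - w) 1 P) atTop (nhds 0))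
    (h2 : ∀ m n, m ≤ n → eLpNorm (G n - G m) 2 P ≤ δ m) (m : ℕ) :
    eLpNorm (w - G m) 2 P ≤ δ m := by
  -- `L¹` convergence gives an almost surely convergent subsequence, to which Fatou's lemma applies
  -- in `L²`.
  obtain ⟨ns, hns, hlim⟩ := (tendstoInMeasure_of_tendsto_eLpNorm one_ne_zero
    (fun n => (hG n).1) hw h1).exists_seq_tendsto_ae
  have h3 := Lp.eLpNorm_lim_le_liminf_eLpNorm (p := 2) (μ := P)
    (f := fun k => G (ns k) - G m) (fun k => (hG (ns k)).1.sub (hG m).1) (w - G m) (by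
      filter_upwards [hlim] with ω hω
      exact hω.sub_const _)
  refine h3.trans (liminf_le_of_frequently_le' (Eventually.frequently ?_))
  filter_upwards [eventually_ge_atTop m] with k hk
  exact h2 m (ns k) (hk.trans (hns.id_le k))

theorem tendsto_integral_mul_of_tendsto_eLpNorm {X Y : ℕ → Ω → ℝ} {X' Y' : Ω → ℝ}
    (hX : ∀ n, MemLp (X n) 2 P) (hY : ∀ n, MemLp (Y n) 2 P) (hX' : MemLp X' 2 P)
    (hY' : MemLp Y' 2 P) (h1 : Tendsto (fun n => eLpNorm (X n - X') 2 P) atTop (nhds 0))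
    (h2 : Tendsto (fun n => eLpNorm (Y n - Y') 2 P) atTop (nhds 0)) :
    Tendsto (fun n => ∫ ω, X n ω * Y n ω ∂P) atTop (nhds (∫ ω, X' ω * Y' ω ∂P)) := by
  have e : ∀ {f g : Ω → ℝ} (hf : MemLp f 2 P) (hg : MemLp g 2 P),
      inner ℝ (hf.toLp f) (hg.toLp g) = ∫ ω, f ω * g ω ∂P := fun {f g} hf hg => by
    rw [L2.inner_def]
    refine integral_congr_ae ?_
    filter_upwards [hf.coeFn_toLp, hg.coeFn_toLp] with ω h3 h4
    rw [h3, h4]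
    simp [mul_comm]
  have t1 := (Lp.tendsto_Lp_iff_tendsto_eLpNorm'' X hX X' hX').2 h1
  have t2 := (Lp.tendsto_Lp_iff_tendsto_eLpNorm'' Y hY Y' hY').2 h2
  simpa only [e] using t1.inner (𝕜 := ℝ) t2

end SquareIntegrable

/-! ### Identification of the `L²` limit, and decay of the covariance. -/

section Decay

open AddMonoidAlgebra

/-- The direction of an edge. -/
def direction (e : Edge (nnKernel 3)) : Site 3 := e.1.2 - e.1.1

theorem direction_mem_units (e : Edge (nnKernel 3)) : direction e ∈ units := by
  rw [← neg_mem_units, direction, neg_sub]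
  exact nnKernel_pos_iff.1 e.2

theorem add_direction (e : Edge (nnKernel 3)) : e.1.1 + direction e = e.1.2 := add_sub_cancel _ _

theorem measurable_shiftGrad (r : Site 3) :
    Measurable (shiftGrad r : GradConf (nnKernel 3) → GradConf (nnKernel 3)) :=
  Measurable.subtype_mk (f := fun (u : GradConf (nnKernel 3)) (e : Edge (nnKernel 3)) =>
      u.1 ⟨(e.1.1 - r, e.1.2 - r), by simpa using e.2⟩)
    (measurable_pi_lambda _ fun _ => (measurable_pi_apply _).comp measurable_subtype_coe)

theorem vectorField_eq_meanDiff (μ : Kernel (Site 3 → ℝ) (GradConf (nnKernel 3)))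
    (e : Edge (nnKernel 3)) (η : Site 3 → ℝ) :
    vectorField gaussianPotential μ e η = meanDiff (μ η) e.1.1 e.1.2 := by
  simp only [vectorField, meanDiff, deriv_gaussianPotential, grad_potential]

/-- Covariance turns a shift of the disorder into a shift of the edge, so a spatial average of the
mean field at fixed `η` becomes an average along the orbit of `η`. -/
theorem vectorField_shift {μ : Kernel (Site 3 → ℝ) (GradConf (nnKernel 3))} {η : Site 3 → ℝ}
    {y : Site 3} (h : μ (shift (-y) η) = (μ η).map (shiftGrad (-y))) (e : Edge (nnKernel 3)) :
    vectorField gaussianPotential μ e (shift (-y) η) =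
      meanDiff (μ η) (e.1.1 + y) (e.1.1 + y + direction e) := by
  have hm : StronglyMeasurable fun u : GradConf (nnKernel 3) => u.1 e :=
    ((measurable_pi_apply e).comp measurable_subtype_coe).stronglyMeasurable
  simp only [vectorField, deriv_gaussianPotential]
  rw [h, integral_map (measurable_shiftGrad _).aemeasurable hm.aestronglyMeasurable, meanDiff]
  congr 1
  funext u
  have hE : 0 < nnKernel 3 (e.1.1 - -y - (e.1.2 - -y)) := by simpa using e.2
  have h2 : (shiftGrad (-y) u).1 e = potential u (e.1.1 - -y) - potential u (e.1.2 - -y) :=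
    (grad_potential u ⟨(e.1.1 - -y, e.1.2 - -y), hE⟩).symm
  rw [add_right_comm, add_direction, h2, sub_neg_eq_add, sub_neg_eq_add]

variable {ν : Measure ℝ} [IsProbabilityMeasure ν]

/-- The part of the vector field created by the disorder up to the time `n` of the lazy walk. -/
def approxField (e : Edge (nnKernel 3)) (n : ℕ) (η : Site 3 → ℝ) : ℝ :=
  act (greenGradient (direction e) (Finset.range n)) η e.1.1

theorem memLp_approxField (hν : MemLp (fun x : ℝ => x) 2 ν) (e : Edge (nnKernel 3)) (n : ℕ) :
    MemLp (approxField e n) 2 (disorderLaw 3 ν) := memLp_act hν _ _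

theorem pairing_one_greenGradient (a : Site 3) (s : Finset ℕ) :
    pairing (fun _ => 1) (greenGradient a s) = 0 := by
  rw [greenGradient, map_smul, pairing_one_mul]
  simp [one_def]

theorem integral_act_greenGradient (hν : MemLp (fun x : ℝ => x) 2 ν) (a x : Site 3)
    (s : Finset ℕ) : ∫ η, act (greenGradient a s) η x ∂(disorderLaw 3 ν) = 0 := by
  rw [integral_act hν, pairing_one_greenGradient, zero_mul]

theorem exists_approxField_cauchy (hν : MemLp (fun x : ℝ => x) 2 ν) :
    ∃ δ : ℕ → ℝ≥0∞, (∀ m, δ m ≠ ⊤) ∧ Tendsto δ atTop (nhds 0) ∧ ∀ (e : Edge (nnKernel 3)) (m n : ℕ),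
      m ≤ n → eLpNorm (approxField e n - approxField e m) 2 (disorderLaw 3 ν) ≤ δ m := by
  obtain ⟨K, hK0, hK⟩ := exists_greenGradient_variance_bound
  set t : ℕ → ℝ := fun k => 1 / √√((k : ℝ) + 1) ^ 5 with ht
  have ht0 : ∀ k, 0 ≤ t k := fun k => by positivity
  have hts : Summable t := summable_inv_sqrt_sqrt
  set σ := Var[fun x : ℝ => x; ν]
  have hσ : 0 ≤ σ := variance_nonneg _ _
  refine ⟨fun m => ENNReal.ofReal (√(σ * K) * ∑' k, t (k + m)), fun m => ENNReal.ofReal_ne_top,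
    ?_, fun e m n hmn => ?_⟩
  · rw [← ENNReal.ofReal_zero, ← mul_zero (√(σ * K))]
    exact ENNReal.tendsto_ofReal ((tendsto_sum_nat_add t).const_mul _)
  · have hd : approxField e n - approxField e m =
        fun η => act (greenGradient (direction e) (Finset.Ico m n)) η e.1.1 := by
      have hg : greenGradient (direction e) (Finset.range n) -
          greenGradient (direction e) (Finset.range m) =
          greenGradient (direction e) (Finset.Ico m n) := by
        rw [greenGradient, greenGradient, greenGradient, ← smul_sub, ← mul_sub,
          Finset.sum_Ico_eq_sub _ hmn]
      funext η
      rw [← hg, map_sub]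
      rfl
    rw [hd, eLpNorm_two_eq_sqrt (memLp_act hν _ _)]
    refine ENNReal.ofReal_le_ofReal (Real.sqrt_le_iff.2
      ⟨mul_nonneg (Real.sqrt_nonneg _) (tsum_nonneg fun k => ht0 _), ?_⟩)
    have hc := covariance_act hν (greenGradient (direction e) (Finset.Ico m n))
      (greenGradient (direction e) (Finset.Ico m n)) e.1.1 e.1.1
    rw [covariance_eq_sub (memLp_act hν _ _) (memLp_act hν _ _),
      integral_act_greenGradient hν, zero_mul, sub_zero, sub_self] at hc
    simp only [Pi.mul_apply, ← sq] at hc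
    rw [hc, mul_pow, Real.sq_sqrt (by positivity), mul_assoc]
    refine mul_le_mul_of_nonneg_left ?_ hσ
    refine (le_abs_self _).trans ((hK _ (direction_mem_units e) _).trans ?_)
    refine mul_le_mul_of_nonneg_left ?_ hK0
    refine pow_le_pow_left₀ (Finset.sum_nonneg fun k _ => ht0 k) ?_ 2
    rw [Finset.sum_Ico_eq_sum_range]
    simp only [add_comm m]
    exact ((summable_nat_add_iff m).2 hts).sum_le_tsum _ fun k _ => ht0 _

variable {μ : Kernel (Site 3 → ℝ) (GradConf (nnKernel 3))}

theorem tendsto_approxField_one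
    (hμ : IsRandomGradientGibbs (nnKernel 3) gaussianPotential (disorderLaw 3 ν) μ)
    (hint : ∀ e : Edge (nnKernel 3), ∀ᵐ η ∂(disorderLaw 3 ν),
      Integrable (fun u : GradConf (nnKernel 3) => deriv gaussianPotential (u.1 e)) (μ η))
    {e : Edge (nnKernel 3)}
    (hX : Integrable (vectorField gaussianPotential μ e) (disorderLaw 3 ν)) :
    Tendsto (fun n => eLpNorm (approxField e n - fun η => vectorField gaussianPotential μ e η -
      ∫ η', vectorField gaussianPotential μ e η' ∂(disorderLaw 3 ν)) 1 (disorderLaw 3 ν))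
      atTop (nhds 0) := by
  have := hμ.markov
  refine (isMixing_of_integrable hX).congr fun n => ?_
  -- By `meanDiff_eq` the Green part minus the centred field is the negative of the orbit average
  -- minus its mean.
  rw [← eLpNorm_neg]
  refine eLpNorm_congr_ae ?_
  filter_upwards [hμ.gibbs, ae_all_iff.2 hint, ae_all_iff.2 fun y => hμ.covariant (-y)]
    with η h1 h2 h3
  simp only [deriv_gaussianPotential] at h2
  have h4 := meanDiff_eq h1 h2 (direction_mem_units e) n e.1.1
  rw [add_direction, ← vectorField_eq_meanDiff, act_eq_pairing (lazyWalk ^ n)] at h4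
  simp only [← vectorField_shift (h3 _)] at h4
  simp only [Pi.neg_apply, Pi.sub_apply, orbitAverage, approxField]
  rw [h4]
  ring

theorem memLp_vectorField (hν : MemLp (fun x : ℝ => x) 2 ν)
    (hμ : IsRandomGradientGibbs (nnKernel 3) gaussianPotential (disorderLaw 3 ν) μ)
    (hint : ∀ e : Edge (nnKernel 3), ∀ᵐ η ∂(disorderLaw 3 ν),
      Integrable (fun u : GradConf (nnKernel 3) => deriv gaussianPotential (u.1 e)) (μ η))
    {e : Edge (nnKernel 3)}
    (hX : Integrable (vectorField gaussianPotential μ e) (disorderLaw 3 ν)) :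
    MemLp (vectorField gaussianPotential μ e) 2 (disorderLaw 3 ν) ∧
      Tendsto (fun n => eLpNorm (approxField e n - fun η => vectorField gaussianPotential μ e η -
        ∫ η', vectorField gaussianPotential μ e η' ∂(disorderLaw 3 ν)) 2 (disorderLaw 3 ν))
        atTop (nhds 0) := by
  obtain ⟨δ, hδt, hδ0, hδ⟩ := exists_approxField_cauchy hν
  have hw : Integrable (fun η => vectorField gaussianPotential μ e η -
    ∫ η', vectorField gaussianPotential μ e η' ∂(disorderLaw 3 ν)) (disorderLaw 3 ν) :=
    hX.sub (integrable_const _)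
  have h := eLpNorm_sub_le_of_cauchy (memLp_approxField hν e) hw.1
    (tendsto_approxField_one hμ hint hX) (hδ e)
  constructor
  -- The Cauchy rate at time 0 is finite, so the centred field differs from a square-integrable
  -- variable by one of finite `L²` norm.
  · have h1 := (MemLp.add (⟨hw.1.sub (memLp_approxField hν e 0).1,
      (h 0).trans_lt (hδt 0).lt_top⟩ : MemLp _ 2 _) (memLp_approxField hν e 0)).add
        (memLp_const (∫ η', vectorField gaussianPotential μ e η' ∂(disorderLaw 3 ν)))
    refine h1.ae_eq (Eventually.of_forall fun η => ?_)
    simp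
  · refine tendsto_of_tendsto_of_tendsto_of_le_of_le tendsto_const_nhds hδ0
      (fun _ => zero_le) fun n => ?_
    dsimp only
    rw [eLpNorm_sub_comm]
    exact h n

/-- The Green parts have mean zero, since a gradient has total weight zero, so their covariances are
integrals of products. Their bound does not depend on the time `n` and is inherited by the `L²`
limit. -/
theorem exists_covariance_bound (hν : MemLp (fun x : ℝ => x) 2 ν)
    (hμ : IsRandomGradientGibbs (nnKernel 3) gaussianPotential (disorderLaw 3 ν) μ)
    (hint : ∀ e : Edge (nnKernel 3), ∀ᵐ η ∂(disorderLaw 3 ν),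
      Integrable (fun u : GradConf (nnKernel 3) => deriv gaussianPotential (u.1 e)) (μ η))
    (hX : ∀ e : Edge (nnKernel 3),
      Integrable (vectorField gaussianPotential μ e) (disorderLaw 3 ν)) :
    ∃ M : ℝ, ∀ e f : Edge (nnKernel 3), e.1.1 ≠ f.1.1 →
      |cov[vectorField gaussianPotential μ e, vectorField gaussianPotential μ f;
        disorderLaw 3 ν]| * siteDist e.1.1 f.1.1 ≤ M := by
  obtain ⟨K, hK0, hK⟩ := exists_greenGradient_covariance_bound
  refine ⟨Var[fun x : ℝ => x; ν] * K, fun e f hef => ?_⟩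
  have hσ : 0 ≤ Var[fun x : ℝ => x; ν] := variance_nonneg _ _
  obtain ⟨me, te⟩ := memLp_vectorField hν hμ hint (hX e)
  obtain ⟨mf, tf⟩ := memLp_vectorField hν hμ hint (hX f)
  have hlim := tendsto_integral_mul_of_tendsto_eLpNorm (memLp_approxField hν e)
    (memLp_approxField hν f) (me.sub (memLp_const _)) (mf.sub (memLp_const _)) te tf
  have hcov : ∀ n, ∫ η, approxField e n η * approxField f n η ∂(disorderLaw 3 ν) =
      Var[fun x : ℝ => x; ν] * (greenGradient (direction e) (Finset.range n) *
        reflect (greenGradient (direction f) (Finset.range n))).coeff (f.1.1 - e.1.1) := fun n => by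
    rw [← covariance_act hν, covariance_eq_sub (memLp_act hν _ _) (memLp_act hν _ _),
      integral_act_greenGradient hν, zero_mul, sub_zero]
    rfl
  have hz : f.1.1 - e.1.1 ≠ 0 := sub_ne_zero.2 hef.symm
  have hdist : siteDist e.1.1 f.1.1 = √(∑ k, (((f.1.1 - e.1.1) k : ℤ) : ℝ) ^ 2) := by
    rw [siteDist]
    congr 1
    refine Finset.sum_congr rfl fun k _ => ?_
    rw [Pi.sub_apply, Int.cast_sub]
    ring
  refine le_of_tendsto (hlim.abs.mul_const (siteDist e.1.1 f.1.1)) (Eventually.of_forall fun n => ?_)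
  rw [hcov, abs_mul, abs_of_nonneg hσ, mul_assoc, hdist]
  exact mul_le_mul_of_nonneg_left
    (hK _ (direction_mem_units e) _ (direction_mem_units f) n _ hz) hσ

theorem limsup_decaySup_lt_top {d : ℕ} {p : Site d → ℝ} {D : Edge p → Edge p → ℝ} {M : ℝ}
    (h : ∀ e f : Edge p, e.1.1 ≠ f.1.1 → |D e f| * siteDist e.1.1 f.1.1 ≤ M) :
    limsup (decaySup D) atTop < ⊤ := by
  refine lt_of_le_of_lt (limsup_le_of_le (a := ENNReal.ofReal M) ?_ ?_) ENNReal.ofReal_lt_top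
  · isBoundedDefault
  -- For `r > 0` the constraint on the distance excludes coinciding base points, and division by
  -- `r⁻¹` is multiplication by `r`, which is at most the distance.
  · filter_upwards [eventually_gt_atTop 0] with r hr
    refine iSup_le fun e => iSup_le fun f => iSup_le fun hef => ENNReal.ofReal_le_ofReal ?_
    have hne : e.1.1 ≠ f.1.1 := fun h0 => by
      rw [h0, siteDist] at hef
      simp only [sub_self] at hef
      norm_num at hef
      linarith
    rw [div_inv_eq_mul]
    exact (mul_le_mul_of_nonneg_left hef (abs_nonneg _)).trans (h e f hne)

end Decay

end

end RandomInterface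

theorem proposition2p4
    (ν : Measure ℝ) [IsProbabilityMeasure ν] (hν : MemLp (fun x : ℝ => x) 2 ν)
    (μ : Kernel (Site 3 → ℝ) (GradConf (nnKernel 3)))
    (hμ : IsRandomGradientGibbs (nnKernel 3) gaussianPotential (disorderLaw 3 ν) μ)
    (hint : ∀ e : Edge (nnKernel 3), ∀ᵐ η ∂(disorderLaw 3 ν),
      Integrable (fun u : GradConf (nnKernel 3) => deriv gaussianPotential (u.1 e)) (μ η))
    (hX : ∀ e : Edge (nnKernel 3),
      Integrable (vectorField gaussianPotential μ e) (disorderLaw 3 ν)) :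
    -- the associated vector field has finite second moments
    (∀ e : Edge (nnKernel 3), MemLp (vectorField gaussianPotential μ e) 2 (disorderLaw 3 ν)) ∧
    -- decay of its covariance with respect to the disorder
    limsup (decaySup fun e f : Edge (nnKernel 3) =>
      cov[vectorField gaussianPotential μ e, vectorField gaussianPotential μ f;
        disorderLaw 3 ν]) atTop < ⊤ ∧
    -- decay of `C(ij, kl) = 𝔼 (X_{ij} X_{kl})` for a measure without tilt
    ((∀ e : Edge (nnKernel 3), ∫ η, vectorField gaussianPotential μ e η ∂(disorderLaw 3 ν) = 0) →
      limsup (decaySup fun e f : Edge (nnKernel 3) =>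
        ∫ η, vectorField gaussianPotential μ e η * vectorField gaussianPotential μ f η
          ∂(disorderLaw 3 ν)) atTop < ⊤) := by
  have hL2 : ∀ e, MemLp (vectorField gaussianPotential μ e) 2 (disorderLaw 3 ν) := fun e =>
    (memLp_vectorField hν hμ hint (hX e)).1
  obtain ⟨M, hM⟩ := exists_covariance_bound hν hμ hint hX
  refine ⟨hL2, limsup_decaySup_lt_top hM, fun h0 => limsup_decaySup_lt_top (M := M)
    fun e f hef => ?_⟩
  have h := hM e f hef
  rw [covariance_eq_sub (hL2 e) (hL2 f), h0 e, zero_mul, sub_zero] at h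
  exact h
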